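/- Let $n\ge 3$ and $\Lambda,\Lambda'\in\mathbb R$. On $\mathbb R^n$ with coordinates $(t,x_1,\dots,x_{n-1})$ let $\eta=-dt^2+dx_1^2+\dots+dx_{n-1}^2$, and let $\bar g_{ab}=\Omega\,\eta_{ab}$ be the conformally flat background with $\Omega=\frac{(n-2)(n-1)}{2\Lambda t^2}$ if $\Lambda>0$ (de Sitter, $t\neq0$), $\Omega=-\frac{(n-2)(n-1)}{2\Lambda x_1^2}$ if $\Lambda<0$ (anti-de Sitter, $x_1\ne0$), and $\Omega=1$ if $\Lambda=0$ (Minkowski). Let $U$ be an open subset of the region where $\bar g$ is defined, let $\mathcal H:U\to\mathbb R$ be a $C^2$ function and $k^a$ a nowhere vanishing $C^2$ vector field on $U$ which is null, $\bar g_{ab}k^ak^b=0$. Put $k_a=\bar g_{ab}k^b$ and consider the generalized Kerr–Schild metric $$g_{ab}=\bar g_{ab}-2\mathcal H\,k_ak_b$$ on $U$. Let $R_{ab}$ be its Ricci tensor, $R$ its scalar curvature, and let a semicolon denote its Levi-Civita covariant derivative. Let $T_{ab}$ be the energy–momentum tensor, i.e. the Einstein equations $R_{ab}-\frac12 R\,g_{ab}+\Lambda'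 g_{ab}=8\pi T_{ab}$ hold on $U$. Then: (1) At every point of $U$ and for every null frame $\boldsymbol m^{(0)}=\boldsymbol n$, $\boldsymbol m^{(1)}=\boldsymbol k$, $\boldsymbol m^{(i)}$ ($2\le i\le n-1$) there, i.e. $\boldsymbol n,\boldsymbol k$ null with $g(\boldsymbol n,\boldsymbol k)=1$ and the $\boldsymbol m^{(i)}$ orthonormal and orthogonal to both, $$R_{00}:=R_{ab}k^ak^b=2\mathcal H\sum_{i=2}^{n-1}L_{i0}^2,\qquad L_{i0}:=k_{a;b}\,m_{(i)}^a k^b .$$ (2) Suppose that $\mathcal H$ does not vanish identically on any nonempty open subset of $U$. Then $\boldsymbol k$ is geodetic on $U$, i.e. at every point of $U$ the covector $k_{a;b}k^b$ is a multiple of $k_a$, if and only if the boost-weight-2 component $T_{00}=T_{ab}k^ak^b$ of the energy–momentum tensor vanishes on $U$. -/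

import Mathlib

namespace KerrSchild

/-- Points of a coordinate patch, and also component arrays of vectors. -/
abbrev Coord (n : ℕ) := Fin n → ℝ

/-- A field of (covariant) rank-two components, in particular a metric in coordinates. -/
abbrev TensorField (n : ℕ) := Coord n → Matrix (Fin n) (Fin n) ℝ

/-- The coordinate partial derivative `∂f/∂xᵃ` at `x`. -/
noncomputable def pderiv {n : ℕ} (a : Fin n) (f : Coord n → ℝ) (x : Coord n) : ℝ :=
  fderiv ℝ f x (Pi.single a 1)

section Geometry

variable {n : ℕ}

/-- `g_{ab} v^a w^b` at the point `x`; also used for `T_{ab} v^a w^b`. -/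
def contract (g : TensorField n) (x : Coord n) (v w : Fin n → ℝ) : ℝ :=
  ∑ a, ∑ b, g x a b * v a * w b

/-- The covariant components `k_a = g_{ab} k^b` of a vector field. -/
def lower (g : TensorField n) (k : Coord n → Fin n → ℝ) (x : Coord n) (a : Fin n) : ℝ :=
  ∑ b, g x a b * k x b

/-- Christoffel symbols `Γ^a_{bc}` of the Levi-Civita connection of `g`. -/
noncomputable def christoffel (g : TensorField n) (a b c : Fin n) (x : Coord n) : ℝ :=
  (1 / 2) * ∑ s, (g x)⁻¹ a s *
    (pderiv c (fun y => g y s b) x + pderiv b (fun y => g y s c) x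
      - pderiv s (fun y => g y b c) x)

/-- Ricci tensor
`R_{bc} = ∂_a Γ^a_{bc} - ∂_c Γ^a_{ba} + Γ^a_{ad} Γ^d_{bc} - Γ^a_{cd} Γ^d_{ba}`. -/
noncomputable def ricci (g : TensorField n) : TensorField n := fun x => Matrix.of fun b c =>
  ∑ a, (pderiv a (christoffel g a b c) x - pderiv c (christoffel g a b a) x)
    + ∑ a, ∑ d, (christoffel g a a d x * christoffel g d b c x
      - christoffel g a c d x * christoffel g d b a x)

/-- Scalar curvature `R = g^{ab} R_{ab}`. -/
noncomputable def scalarCurvature (g : TensorField n) (x : Coord n) : ℝ :=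
  ∑ a, ∑ b, (g x)⁻¹ a b * ricci g x a b

/-- Einstein's field equations `R_{ab} - (1/2) R g_{ab} + Λ g_{ab} = 8π T_{ab}` on `U`. -/
def EinsteinEquations (U : Set (Coord n)) (g : TensorField n) (cosm : ℝ)
    (T : TensorField n) : Prop :=
  ∀ x ∈ U, ∀ a b, ricci g x a b - (1 / 2) * scalarCurvature g x * g x a b + cosm * g x a b
    = 8 * Real.pi * T x a b

/-- Covariant derivative `k_{a;b} = ∂_b k_a - Γ^c_{ab} k_c` of the vector field `k`, with its
index lowered by `g`. -/
noncomputable def covDeriv (g : TensorField n) (k : Coord n → Fin n → ℝ) (a b : Fin n)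
    (x : Coord n) : ℝ :=
  pderiv b (fun y => lower g k y a) x - ∑ c, christoffel g c a b x * lower g k x c

/-- `k` is geodetic on `U`: `k_{a;b} k^b ∝ k_a` at every point of `U` (the parametrization need
not be affine). -/
def IsGeodetic (U : Set (Coord n)) (g : TensorField n) (k : Coord n → Fin n → ℝ) : Prop :=
  ∀ x ∈ U, ∃ μ : ℝ, ∀ a, ∑ b, covDeriv g k a b x * k x b = μ * lower g k x a

/-- A null frame at `x`: `m 0` and `m 1` are null with `g(m 0, m 1) = 1`, and the vectors `m i`
with `2 ≤ i` are orthonormal and orthogonal to `m 0` and `m 1`. -/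
def IsNullFrame (g : TensorField n) (x : Coord n) (m : Fin n → Fin n → ℝ) : Prop :=
  ∀ c d : Fin n, contract g x (m c) (m d) =
    if (c.val = 0 ∧ d.val = 1) ∨ (c.val = 1 ∧ d.val = 0) ∨ (2 ≤ c.val ∧ c = d) then 1 else 0

/-- The Ricci rotation coefficient `L_{i0} = k_{a;b} m_(i)^a k^b`, where `mi` are the contravariant
components of the frame vector `m_(i)` at `x`. -/
noncomputable def rotationL0 (g : TensorField n) (k : Coord n → Fin n → ℝ) (x : Coord n)
    (mi : Fin n → ℝ) : ℝ :=
  ∑ a, ∑ b, covDeriv g k a b x * mi a * k x b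

end Geometry

/-- Minkowski metric `-dt² + dx₁² + … + dx_{n-1}²`, with `t` the coordinate number `0`. -/
def minkowski (n : ℕ) : Matrix (Fin n) (Fin n) ℝ :=
  Matrix.diagonal fun a => if a.val = 0 then -1 else 1

/-- Conformal factor of the background with cosmological constant `Λ`: de Sitter for `0 < Λ`,
anti-de Sitter for `Λ < 0`, Minkowski for `Λ = 0`. -/
noncomputable def conformalFactor (n : ℕ) [NeZero n] (Λ : ℝ) (x : Coord n) : ℝ :=
  if 0 < Λ then ((n : ℝ) - 2) * ((n : ℝ) - 1) / (2 * Λ * x 0 ^ 2)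
  else if Λ < 0 then -(((n : ℝ) - 2) * ((n : ℝ) - 1) / (2 * Λ * x 1 ^ 2))
  else 1

/-- The set of coordinate values on which the background metric is defined. -/
def backgroundDomain (n : ℕ) [NeZero n] (Λ : ℝ) : Set (Coord n) :=
  {x | (0 < Λ → x 0 ≠ 0) ∧ (Λ < 0 → x 1 ≠ 0)}

/-- The conformally flat (anti-)de Sitter (or Minkowski) metric. -/
noncomputable def background (n : ℕ) [NeZero n] (Λ : ℝ) : TensorField n :=
  fun x => conformalFactor n Λ x • minkowski n

/-- The generalized Kerr–Schild metric `g_{ab} = ḡ_{ab} - 2 H k_a k_b`, where `k_a = ḡ_{ab} k^b`. -/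
noncomputable def gksMetric (n : ℕ) [NeZero n] (Λ : ℝ) (H : Coord n → ℝ)
    (k : Coord n → Fin n → ℝ) : TensorField n :=
  fun x => Matrix.of fun a b => background n Λ x a b
    - 2 * H x * lower (background n Λ) k x a * lower (background n Λ) k x b

end KerrSchild

/-!
Write `κ_a` for the covector of `k`, `A_a = k_{a;b} k^b` for its acceleration, and compare the
Levi-Civita connection of `g = ḡ - 2 H κ κ` with that of the background `ḡ`. Nothing about `ḡ` is
used at first beyond the nullity of `k`, which gives `k^a k_{a;b} = 0` and `A_a k^a = 0`. Hence both
metrics lower `k` to `κ`, `g⁻¹ = ḡ⁻¹ + 2 H k k`, and the difference tensor `C^a_{bc}` of the two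
connections satisfies

* `C^a_{ab} = 0` (`sum_connDiff_trace`),
* `C^a_{bc} k^c = -((k·∂H) k^a κ_b + H A^a κ_b + H k^a A_b)` (`sum_connDiff_mul`), and so
  `C^a_{bc} k^b k^c = 0`.

In `R_{bc} k^b k^c - R̄_{bc} k^b k^c` the only second derivatives of the metric that survive the
trace condition are those in `k^b k^c ∂_a C^a_{bc}`. As `C^a_{bc} k^b k^c` vanishes on an open set,
they can be thrown onto `k`, and what is left is `-2 M^a_b ∇_a k^b - M^a_b M^b_a` with
`M^a_b = C^a_{bc} k^c` (`contract_ricci_sub`). With the formula for `M` this is `2 H A_a A^a`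
(`contract_ricci_kerrSchild`).

The backgrounds at hand are Einstein metrics, so that `R̄_{bc} k^b k^c = 0`: half the logarithmic
gradient `φ` of the conformal factor obeys `∂_b φ_c = φ_b φ_c` (`contract_ricci_conformal`). In a
null frame with `m 1 = k` the norm `A_a A^a` is the sum of the `L_{i0}²`, since `A` is orthogonal
to `k` (`IsNullFrame.sum_inv_mul_mul`); this is the first claim.

For the second, the Einstein equations turn `T_{ab} k^a k^b = 0` into `H A_a A^a = 0`. The
set where `H ≠ 0` is dense and `A_a A^a` is continuous, so this means `A_a A^a = 0` on `U`; and in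
Lorentzian signature a null covector orthogonal to the null vector `k` is a multiple of `κ`
(`exists_acceleration_eq_iff`).
-/

namespace KerrSchild

open Finset Topology

variable {n : ℕ}

/-! ### Partial derivatives in coordinates -/

theorem pderiv_add (a : Fin n) {f h : Coord n → ℝ} {x : Coord n}
    (hf : DifferentiableAt ℝ f x) (hh : DifferentiableAt ℝ h x) :
    pderiv a (fun y => f y + h y) x = pderiv a f x + pderiv a h x := by
  simp [pderiv, fderiv_fun_add hf hh]

theorem pderiv_sub (a : Fin n) {f h : Coord n → ℝ} {x : Coord n}
    (hf : DifferentiableAt ℝ f x) (hh : DifferentiableAt ℝ h x) :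
    pderiv a (fun y => f y - h y) x = pderiv a f x - pderiv a h x := by
  simp [pderiv, fderiv_fun_sub hf hh]

theorem pderiv_mul (a : Fin n) {f h : Coord n → ℝ} {x : Coord n}
    (hf : DifferentiableAt ℝ f x) (hh : DifferentiableAt ℝ h x) :
    pderiv a (fun y => f y * h y) x = f x * pderiv a h x + pderiv a f x * h x := by
  simp [pderiv, fderiv_fun_mul hf hh, mul_comm]

theorem pderiv_const_mul (a : Fin n) (c : ℝ) {f : Coord n → ℝ} {x : Coord n}
    (hf : DifferentiableAt ℝ f x) :
    pderiv a (fun y => c * f y) x = c * pderiv a f x := by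
  simp [pderiv, fderiv_const_mul hf]

theorem pderiv_sum {ι : Type*} (s : Finset ι) (a : Fin n) {f : ι → Coord n → ℝ} {x : Coord n}
    (hf : ∀ i, DifferentiableAt ℝ (f i) x) :
    pderiv a (fun y => ∑ i ∈ s, f i y) x = ∑ i ∈ s, pderiv a (f i) x := by
  simp [pderiv, fderiv_fun_sum (fun i _ => hf i)]

theorem pderiv_sum_mul {ι : Type*} [Fintype ι] (a : Fin n) {f h : ι → Coord n → ℝ} {x : Coord n}
    (hf : ∀ i, DifferentiableAt ℝ (f i) x) (hh : ∀ i, DifferentiableAt ℝ (h i) x) :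
    pderiv a (fun y => ∑ i, f i y * h i y) x =
      ∑ i, (f i x * pderiv a (h i) x + pderiv a (f i) x * h i x) := by
  rw [pderiv_sum _ _ fun i => (hf i).fun_mul (hh i)]
  exact sum_congr rfl fun i _ => pderiv_mul a (hf i) (hh i)

theorem pderiv_congr {U : Set (Coord n)} (hU : IsOpen U) {x : Coord n} (hx : x ∈ U)
    {f h : Coord n → ℝ} (hfh : ∀ y ∈ U, f y = h y) (a : Fin n) :
    pderiv a f x = pderiv a h x := by
  have : f =ᶠ[𝓝 x] h := Filter.eventually_of_mem (hU.mem_nhds hx) hfh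
  simp [pderiv, this.fderiv_eq]

theorem pderiv_const (a : Fin n) (c : ℝ) (x : Coord n) :
    pderiv a (fun _ => c) x = 0 := by simp [pderiv]

theorem differentiableAt_pderiv (a : Fin n) {f : Coord n → ℝ} {x : Coord n}
    (hf : ContDiffAt ℝ 2 f x) : DifferentiableAt ℝ (pderiv a f) x := by
  have h : ContDiffAt ℝ 1 (fderiv ℝ f) x := hf.fderiv_right (by norm_num)
  exact (h.differentiableAt (by norm_num)).clm_apply (differentiableAt_const _)

/-! ### Christoffel symbols and the Ricci form -/

/-- Christoffel symbols of the first kind, with the lowered index in front. -/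
noncomputable def christoffelLower (g : TensorField n) (s b c : Fin n) (x : Coord n) : ℝ :=
  (1 / 2) * (pderiv c (fun y => g y s b) x + pderiv b (fun y => g y s c) x
    - pderiv s (fun y => g y b c) x)

theorem christoffel_eq_sum (g : TensorField n) (a b c : Fin n) (x : Coord n) :
    christoffel g a b c x = ∑ s, (g x)⁻¹ a s * christoffelLower g s b c x := by
  simp only [christoffel, christoffelLower, mul_sum]
  exact sum_congr rfl fun s _ => by ring

theorem inv_contract_contract {M : Matrix (Fin n) (Fin n) ℝ} (hM : IsUnit M.det)
    (v : Fin n → ℝ) (a : Fin n) : ∑ s, M⁻¹ a s * ∑ b, M s b * v b = v a := by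
  have := congrFun (show M⁻¹.mulVec (M.mulVec v) = v by
    rw [Matrix.mulVec_mulVec, Matrix.nonsing_inv_mul _ hM, Matrix.one_mulVec]) a
  simpa [Matrix.mulVec, dotProduct] using this

theorem contract_inv_contract {M : Matrix (Fin n) (Fin n) ℝ} (hM : IsUnit M.det)
    (v : Fin n → ℝ) (a : Fin n) : ∑ s, M a s * ∑ b, M⁻¹ s b * v b = v a := by
  have := congrFun (show M.mulVec (M⁻¹.mulVec v) = v by
    rw [Matrix.mulVec_mulVec, Matrix.mul_nonsing_inv _ hM, Matrix.one_mulVec]) a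
  simpa [Matrix.mulVec, dotProduct] using this

theorem christoffelLower_eq_sum {g : TensorField n} {x : Coord n} (hg : IsUnit (g x).det)
    (s b c : Fin n) :
    christoffelLower g s b c x = ∑ d, g x s d * christoffel g d b c x := by
  simp only [christoffel_eq_sum]
  exact (contract_inv_contract hg (fun s => christoffelLower g s b c x) s).symm

theorem christoffel_symm {g : TensorField n} (hg : ∀ y, (g y).IsSymm) (a b c : Fin n)
    (x : Coord n) : christoffel g a b c x = christoffel g a c b x := by
  simp only [christoffel]
  congr 1
  refine sum_congr rfl fun s _ => ?_
  simp only [fun y => (hg y).apply b c]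
  ring

theorem differentiableAt_inv_apply {g : TensorField n} {x : Coord n}
    (hg : ∀ a b, DifferentiableAt ℝ (fun y => g y a b) x) (hdet : IsUnit (g x).det)
    (a b : Fin n) : DifferentiableAt ℝ (fun y => (g y)⁻¹ a b) x := by
  have hd : ∀ F : TensorField n, (∀ a b, DifferentiableAt ℝ (fun y => F y a b) x) →
      DifferentiableAt ℝ (fun y => (F y).det) x := by
    intro F hF
    simp only [Matrix.det_apply']
    fun_prop
  simp only [Matrix.inv_def, Matrix.smul_apply, smul_eq_mul, Ring.inverse_eq_inv',
    Matrix.adjugate_apply]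
  refine ((hd g hg).inv hdet.ne_zero).mul (hd _ fun i j => ?_)
  by_cases h : i = b
  · subst h; simp
  · simpa [Matrix.updateRow_ne h] using hg i j

theorem differentiableAt_christoffel {g : TensorField n} {x : Coord n}
    (hg : ∀ a b, ContDiffAt ℝ 2 (fun y => g y a b) x) (hdet : IsUnit (g x).det)
    (a b c : Fin n) : DifferentiableAt ℝ (christoffel g a b c) x := by
  have h1 := differentiableAt_inv_apply (fun a b => (hg a b).differentiableAt (by norm_num)) hdet
  have h2 := fun a b c => differentiableAt_pderiv a (hg b c)
  exact (DifferentiableAt.fun_sum fun s _ => (h1 a s).mul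
    (((h2 c s b).add (h2 b s c)).sub (h2 s b c))).const_mul _

/-- The quadratic form of the Ricci tensor on `v`, with the contractions of the Christoffel symbols
collected. -/
theorem contract_ricci {g : TensorField n} (hg : ∀ y, (g y).IsSymm) (x : Coord n)
    (v : Fin n → ℝ) :
    contract (ricci g) x v v =
      ∑ a, ∑ b, ∑ c, pderiv a (christoffel g a b c) x * v b * v c
      - ∑ b, ∑ c, (∑ a, pderiv c (christoffel g a b a) x) * v b * v c
      + ∑ d, (∑ a, christoffel g a a d x) * ∑ b, ∑ c, christoffel g d b c x * v b * v c
      - ∑ a, ∑ d, (∑ c, christoffel g a d c x * v c) * ∑ b, christoffel g d a b x * v b := by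
  have e1 : ∑ a, ∑ b, ∑ c, pderiv a (christoffel g a b c) x * v b * v c =
      ∑ b, ∑ c, (∑ a, pderiv a (christoffel g a b c) x) * v b * v c := by
    rw [sum_comm]
    refine sum_congr rfl fun b _ => ?_
    rw [sum_comm]
    simp only [sum_mul]
  have e2 : ∑ d, (∑ a, christoffel g a a d x) * ∑ b, ∑ c, christoffel g d b c x * v b * v c =
      ∑ b, ∑ c, (∑ a, ∑ d, christoffel g a a d x * christoffel g d b c x) * v b * v c := by
    simp only [mul_sum, sum_mul]
    rw [sum_comm]
    refine sum_congr rfl fun b _ => ?_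
    rw [sum_comm]
    refine sum_congr rfl fun c _ => ?_
    rw [sum_comm]
    exact sum_congr rfl fun a _ => sum_congr rfl fun d _ => by ring
  have e3 : ∑ a, ∑ d, (∑ c, christoffel g a d c x * v c) * ∑ b, christoffel g d a b x * v b =
      ∑ b, ∑ c, (∑ a, ∑ d, christoffel g a c d x * christoffel g d b a x) * v b * v c := by
    simp only [mul_sum, sum_mul]
    have : ∀ a, ∑ d, ∑ b, ∑ c, christoffel g a d c x * v c * (christoffel g d a b x * v b) =
        ∑ b, ∑ c, ∑ d, christoffel g a c d x * christoffel g d b a x * v b * v c := by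
      intro a
      rw [sum_comm]
      refine sum_congr rfl fun b _ => ?_
      rw [sum_comm]
      refine sum_congr rfl fun c _ => sum_congr rfl fun d _ => ?_
      rw [christoffel_symm hg a d c, christoffel_symm hg d a b]; ring
    simp only [this]
    rw [sum_comm]
    refine sum_congr rfl fun b _ => ?_
    rw [sum_comm]
  rw [e1, e2, e3]
  simp only [contract, ricci, Matrix.of_apply, sum_sub_distrib, sum_add_distrib, add_mul, sub_mul]
  ring

/-! ### Null vector fields and Kerr–Schild metrics -/

/-- The Kerr–Schild deformation `g_{ab} = G_{ab} - 2 H k_a k_b` of an arbitrary metric `G`, the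
index of `k` being lowered with `G`. -/
noncomputable def kerrSchild (G : TensorField n) (H : Coord n → ℝ) (k : Coord n → Fin n → ℝ) :
    TensorField n :=
  fun x => Matrix.of fun a b => G x a b - 2 * H x * lower G k x a * lower G k x b

/-- `G` is a symmetric `C²` metric on the open set `U`, and `H`, `k` are a `C²` function and a
`C²` vector field on `U`, the latter `G`-null. Symmetry is asked for everywhere, which spares the
derivatives a restriction to `U`. -/
structure IsKerrSchildData (U : Set (Coord n)) (G : TensorField n) (H : Coord n → ℝ)
    (k : Coord n → Fin n → ℝ) : Prop where
  isOpen : IsOpen U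
  symm : ∀ x, (G x).IsSymm
  isUnit_det : ∀ x ∈ U, IsUnit (G x).det
  contDiffAt_metric : ∀ x ∈ U, ∀ a b, ContDiffAt ℝ 2 (fun y => G y a b) x
  contDiffAt_function : ∀ x ∈ U, ContDiffAt ℝ 2 H x
  contDiffAt_vector : ∀ x ∈ U, ∀ a, ContDiffAt ℝ 2 (fun y => k y a) x
  null : ∀ x ∈ U, contract G x (k x) (k x) = 0

/-- Covariant derivative `∇_b k^c` of the vector field `k`, its index left upstairs. -/
noncomputable def covDerivVec (G : TensorField n) (k : Coord n → Fin n → ℝ) (c b : Fin n)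
    (x : Coord n) : ℝ :=
  pderiv b (fun y => k y c) x + ∑ d, christoffel G c b d x * k x d

/-- The covector `A_a = k_{a;b} k^b`, the acceleration of the integral curves of `k`. -/
noncomputable def acceleration (G : TensorField n) (k : Coord n → Fin n → ℝ) (x : Coord n)
    (a : Fin n) : ℝ :=
  ∑ b, covDeriv G k a b x * k x b

theorem contract_self_eq_lower (G : TensorField n) (k : Coord n → Fin n → ℝ) (x : Coord n) :
    contract G x (k x) (k x) = ∑ a, lower G k x a * k x a := by
  simp only [contract, lower, sum_mul]
  exact sum_congr rfl fun a _ => sum_congr rfl fun b _ => by ring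

namespace IsKerrSchildData

variable {U : Set (Coord n)} {G : TensorField n} {H : Coord n → ℝ} {k : Coord n → Fin n → ℝ}
  {x : Coord n}

theorem differentiableAt_lower (D : IsKerrSchildData U G H k) (hx : x ∈ U) (a : Fin n) :
    DifferentiableAt ℝ (fun y => lower G k y a) x :=
  DifferentiableAt.fun_sum fun b _ =>
    ((D.contDiffAt_metric x hx a b).differentiableAt (by norm_num)).mul
      ((D.contDiffAt_vector x hx b).differentiableAt (by norm_num))

theorem contDiffAt_lower (D : IsKerrSchildData U G H k) (hx : x ∈ U) (a : Fin n) :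
    ContDiffAt ℝ 2 (fun y => lower G k y a) x :=
  ContDiffAt.sum fun b _ => (D.contDiffAt_metric x hx a b).mul (D.contDiffAt_vector x hx b)

theorem contDiffAt_kerrSchild (D : IsKerrSchildData U G H k) (hx : x ∈ U) (a b : Fin n) :
    ContDiffAt ℝ 2 (fun y => kerrSchild G H k y a b) x :=
  (D.contDiffAt_metric x hx a b).sub (((contDiffAt_const.mul (D.contDiffAt_function x hx)).mul
    (D.contDiffAt_lower hx a)).mul (D.contDiffAt_lower hx b))

theorem lower_null (D : IsKerrSchildData U G H k) (hx : x ∈ U) :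
    ∑ a, lower G k x a * k x a = 0 := by
  rw [← contract_self_eq_lower, D.null x hx]

theorem kerrSchild_symm (D : IsKerrSchildData U G H k) (y : Coord n) :
    (kerrSchild G H k y).IsSymm := by
  ext a b
  simp only [Matrix.transpose_apply, kerrSchild, Matrix.of_apply, (D.symm y).apply a b]
  ring

/-- Since `k` is null, `g_{ab} v^b = G_{ab} v^b` for every `v` orthogonal to `k`. -/
theorem sum_kerrSchild_mul_eq {v : Fin n → ℝ} (hv : ∑ b, lower G k x b * v b = 0) (a : Fin n) :
    ∑ b, kerrSchild G H k x a b * v b = ∑ b, G x a b * v b := by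
  have : ∑ b, kerrSchild G H k x a b * v b =
      ∑ b, G x a b * v b - 2 * H x * lower G k x a * ∑ b, lower G k x b * v b := by
    simp only [mul_sum, ← sum_sub_distrib, kerrSchild, Matrix.of_apply]
    exact sum_congr rfl fun b _ => by ring
  rw [this, hv, mul_zero, sub_zero]

theorem lower_kerrSchild (D : IsKerrSchildData U G H k) (hx : x ∈ U) (a : Fin n) :
    lower (kerrSchild G H k) k x a = lower G k x a :=
  sum_kerrSchild_mul_eq (D.lower_null hx) a

theorem sum_inv_mul_lower (D : IsKerrSchildData U G H k) (hx : x ∈ U) (a : Fin n) :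
    ∑ s, (G x)⁻¹ a s * lower G k x s = k x a :=
  inv_contract_contract (D.isUnit_det x hx) (k x) a

/-- The inverse of a Kerr–Schild metric is again of Kerr–Schild form. -/
theorem kerrSchild_mul_eq_one (D : IsKerrSchildData U G H k) (hx : x ∈ U) :
    kerrSchild G H k x * ((G x)⁻¹ + Matrix.of fun a b => 2 * H x * k x a * k x b) = 1 := by
  have h1 := Matrix.mul_nonsing_inv _ (D.isUnit_det x hx)
  have hsym : ∀ a s, (G x)⁻¹ a s = (G x)⁻¹ s a := fun a s => by
    have := Matrix.transpose_nonsing_inv (G x)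
    rw [(D.symm x).eq] at this
    conv_lhs => rw [← this, Matrix.transpose_apply]
  ext a b
  have h2 : ∑ c, G x a c * (G x)⁻¹ c b = (1 : Matrix (Fin n) (Fin n) ℝ) a b := by
    rw [← h1, Matrix.mul_apply]
  have h3 := D.sum_inv_mul_lower hx b
  have h4 := D.lower_null hx
  have h5 : ∑ c, G x a c * k x c = lower G k x a := rfl
  rw [← h2, Matrix.mul_apply]
  have : ∑ j, kerrSchild G H k x a j *
        ((G x)⁻¹ + Matrix.of fun a b => 2 * H x * k x a * k x b) j b =
      ∑ c, G x a c * (G x)⁻¹ c b + 2 * H x * k x b * ∑ c, G x a c * k x c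
        - 2 * H x * lower G k x a * ∑ s, (G x)⁻¹ b s * lower G k x s
        - 4 * H x ^ 2 * lower G k x a * k x b * ∑ a, lower G k x a * k x a := by
    simp only [mul_sum, ← sum_sub_distrib, ← sum_add_distrib, kerrSchild, Matrix.of_apply,
      Matrix.add_apply]
    exact sum_congr rfl fun c _ => by rw [hsym b c]; ring
  rw [this, h3, h4, h5]
  ring

theorem kerrSchild_inv (D : IsKerrSchildData U G H k) (hx : x ∈ U) :
    (kerrSchild G H k x)⁻¹ = (G x)⁻¹ + Matrix.of fun a b => 2 * H x * k x a * k x b :=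
  Matrix.inv_eq_right_inv (D.kerrSchild_mul_eq_one hx)

theorem isUnit_det_kerrSchild (D : IsKerrSchildData U G H k) (hx : x ∈ U) :
    IsUnit (kerrSchild G H k x).det :=
  Matrix.isUnit_det_of_right_inverse (D.kerrSchild_mul_eq_one hx)

/-- Lowering an index commutes with covariant differentiation: the connection is metric. -/
theorem covDeriv_eq_sum (D : IsKerrSchildData U G H k) (hx : x ∈ U) (a b : Fin n) :
    covDeriv G k a b x = ∑ c, G x a c * covDerivVec G k c b x := by
  have hG := fun a b => (D.contDiffAt_metric x hx a b).differentiableAt (by norm_num)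
  have hk := fun a => (D.contDiffAt_vector x hx a).differentiableAt (by norm_num)
  have e1 : pderiv b (fun y => lower G k y a) x =
      ∑ d, (G x a d * pderiv b (fun y => k y d) x + pderiv b (fun y => G y a d) x * k x d) := 
    pderiv_sum_mul b (hG a) hk
  have e2 : ∑ c, christoffel G c a b x * lower G k x c =
      ∑ d, christoffelLower G d a b x * k x d := by
    simp only [lower, christoffelLower_eq_sum (D.isUnit_det x hx), mul_sum, sum_mul]
    rw [sum_comm]
    exact sum_congr rfl fun d _ => sum_congr rfl fun c _ => by
      rw [(D.symm x).apply d c]; ring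
  have e3 : ∑ c, G x a c * covDerivVec G k c b x =
      ∑ d, (G x a d * pderiv b (fun y => k y d) x + christoffelLower G a b d x * k x d) := by
    simp only [covDerivVec, christoffelLower_eq_sum (D.isUnit_det x hx), mul_sum, sum_mul,
      mul_add, sum_add_distrib]
    congr 1
    rw [sum_comm]
    exact sum_congr rfl fun d _ => sum_congr rfl fun c _ => by ring
  rw [covDeriv, e1, e2, e3, ← sum_sub_distrib]
  refine sum_congr rfl fun d _ => ?_
  simp only [christoffelLower, fun y => (D.symm y).apply d a, fun y => (D.symm y).apply d b]
  have : (fun y => G y a b) = fun y => G y b a := funext fun y => (D.symm y).apply b a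
  rw [this]
  ring

theorem sum_covDeriv_mul_eq (D : IsKerrSchildData U G H k) (hx : x ∈ U) (b : Fin n) :
    ∑ a, covDeriv G k a b x * k x a = ∑ c, lower G k x c * covDerivVec G k c b x := by
  simp only [D.covDeriv_eq_sum hx, lower, sum_mul]
  rw [sum_comm]
  exact sum_congr rfl fun c _ => sum_congr rfl fun a _ => by
    rw [(D.symm x).apply c a]; ring

/-- Differentiating `k_a k^a = 0` gives `k_c ∇_b k^c = 0`. -/
theorem sum_lower_mul_covDerivVec (D : IsKerrSchildData U G H k) (hx : x ∈ U) (b : Fin n) :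
    ∑ c, lower G k x c * covDerivVec G k c b x = 0 := by
  have hk := fun a => (D.contDiffAt_vector x hx a).differentiableAt (by norm_num)
  have e1 : ∑ a, (lower G k x a * pderiv b (fun y => k y a) x +
      pderiv b (fun y => lower G k y a) x * k x a) = 0 := by
    rw [← pderiv_const b 0 x, ← pderiv_congr D.isOpen hx (fun y hy => D.lower_null hy) b,
      pderiv_sum_mul b (D.differentiableAt_lower hx) hk]
  have e2 : ∑ c, lower G k x c * covDerivVec G k c b x + ∑ a, covDeriv G k a b x * k x a =
      ∑ a, (lower G k x a * pderiv b (fun y => k y a) x +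
      pderiv b (fun y => lower G k y a) x * k x a) := by
    simp only [covDerivVec, covDeriv, mul_add, sub_mul, sum_add_distrib, sum_sub_distrib, mul_sum,
      sum_mul]
    have : ∑ c, ∑ d, lower G k x c * (christoffel G c b d x * k x d) =
        ∑ a, ∑ c, christoffel G c a b x * lower G k x c * k x a := by
      rw [sum_comm]
      exact sum_congr rfl fun d _ => sum_congr rfl fun c _ => by
        rw [christoffel_symm D.symm c b d]; ring
    rw [this]; ring
  linarith [D.sum_covDeriv_mul_eq hx b]

theorem sum_covDeriv_mul (D : IsKerrSchildData U G H k) (hx : x ∈ U) (b : Fin n) :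
    ∑ a, covDeriv G k a b x * k x a = 0 :=
  (D.sum_covDeriv_mul_eq hx b).trans (D.sum_lower_mul_covDerivVec hx b)

/-- The acceleration of a null field is orthogonal to it. -/
theorem sum_acceleration_mul (D : IsKerrSchildData U G H k) (hx : x ∈ U) :
    ∑ a, acceleration G k x a * k x a = 0 := by
  simp only [acceleration, sum_mul]
  rw [sum_comm]
  refine sum_eq_zero fun b _ => ?_
  have := D.sum_covDeriv_mul hx b
  calc _ = k x b * ∑ a, covDeriv G k a b x * k x a := by
        rw [mul_sum]; exact sum_congr rfl fun a _ => by ring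
    _ = 0 := by rw [this, mul_zero]

end IsKerrSchildData

/-! ### The difference of the two connections -/

/-- The difference tensor `C^a_{bc} = Γ^a_{bc} - Γ̄^a_{bc}` of the connections of the Kerr–Schild
metric and of its background. -/
noncomputable def connDiff (G : TensorField n) (H : Coord n → ℝ) (k : Coord n → Fin n → ℝ)
    (a b c : Fin n) (x : Coord n) : ℝ :=
  christoffel (kerrSchild G H k) a b c x - christoffel G a b c x

/-- The difference tensor with its first index lowered by the Kerr–Schild metric: half of
`∇_c h_{sb} + ∇_b h_{sc} - ∇_s h_{bc}` for `h_{ab} = -2 H k_a k_b` and the background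
connection `∇`, written out. -/
noncomputable def connDiffLower (G : TensorField n) (H : Coord n → ℝ) (k : Coord n → Fin n → ℝ)
    (s b c : Fin n) (x : Coord n) : ℝ :=
  -(pderiv c H x * lower G k x s * lower G k x b
    + H x * covDeriv G k s c x * lower G k x b + H x * lower G k x s * covDeriv G k b c x
    + pderiv b H x * lower G k x s * lower G k x c
    + H x * covDeriv G k s b x * lower G k x c + H x * lower G k x s * covDeriv G k c b x
    - pderiv s H x * lower G k x b * lower G k x c
    - H x * covDeriv G k b s x * lower G k x c - H x * lower G k x b * covDeriv G k c s x)

namespace IsKerrSchildData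

variable {U : Set (Coord n)} {G : TensorField n} {H : Coord n → ℝ} {k : Coord n → Fin n → ℝ}
  {x : Coord n}

theorem pderiv_kerrSchild (D : IsKerrSchildData U G H k) (hx : x ∈ U) (s b c : Fin n) :
    pderiv c (fun y => kerrSchild G H k y s b) x = pderiv c (fun y => G y s b) x -
      2 * (pderiv c H x * lower G k x s * lower G k x b
        + H x * pderiv c (fun y => lower G k y s) x * lower G k x b
        + H x * lower G k x s * pderiv c (fun y => lower G k y b) x) := by
  have hH := (D.contDiffAt_function x hx).differentiableAt (by norm_num)
  have hG := (D.contDiffAt_metric x hx s b).differentiableAt (by norm_num)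
  have hs := D.differentiableAt_lower hx s
  have hb := D.differentiableAt_lower hx b
  have h2 := hH.const_mul 2
  have e : pderiv c (fun y => kerrSchild G H k y s b) x = _ :=
    pderiv_sub c hG ((h2.fun_mul hs).fun_mul hb)
  rw [e, pderiv_mul c (h2.fun_mul hs) hb, pderiv_mul c h2 hs, pderiv_const_mul c 2 hH]
  ring

/-- The Koszul formula for the difference tensor, before inverting the metric. -/
theorem christoffelLower_kerrSchild (D : IsKerrSchildData U G H k) (hx : x ∈ U) (s b c : Fin n) :
    christoffelLower (kerrSchild G H k) s b c x =
      connDiffLower G H k s b c x + ∑ d, kerrSchild G H k x s d * christoffel G d b c x := by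
  have e1 : ∑ d, kerrSchild G H k x s d * christoffel G d b c x = christoffelLower G s b c x
      - 2 * H x * lower G k x s * ∑ d, christoffel G d b c x * lower G k x d := by
    rw [christoffelLower_eq_sum (D.isUnit_det x hx)]
    simp only [kerrSchild, Matrix.of_apply, mul_sum, ← sum_sub_distrib]
    exact sum_congr rfl fun d _ => by ring
  have e2 : ∀ a b, pderiv b (fun y => lower G k y a) x =
      covDeriv G k a b x + ∑ c, christoffel G c a b x * lower G k x c := by
    intro a b; simp [covDeriv]
  have e3 : ∀ a b, ∑ d, christoffel G d a b x * lower G k x d =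
      ∑ d, christoffel G d b a x * lower G k x d := fun a b =>
    sum_congr rfl fun d _ => by rw [christoffel_symm D.symm]
  rw [e1]
  simp only [christoffelLower, D.pderiv_kerrSchild hx, connDiffLower, e2]
  rw [e3 c b, e3 s b, e3 s c]
  ring

theorem connDiff_eq_sum (D : IsKerrSchildData U G H k) (hx : x ∈ U) (a b c : Fin n) :
    connDiff G H k a b c x = ∑ s, (kerrSchild G H k x)⁻¹ a s * connDiffLower G H k s b c x := by
  rw [connDiff, christoffel_eq_sum]
  simp only [D.christoffelLower_kerrSchild hx, mul_add, sum_add_distrib]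
  rw [inv_contract_contract (D.isUnit_det_kerrSchild hx) (fun d => christoffel G d b c x) a]
  ring

theorem connDiff_symm (D : IsKerrSchildData U G H k) (a b c : Fin n) :
    connDiff G H k a b c x = connDiff G H k a c b x := by
  rw [connDiff, connDiff, christoffel_symm D.symm, christoffel_symm D.kerrSchild_symm]

theorem sum_kerrSchild_inv_mul_lower (D : IsKerrSchildData U G H k) (hx : x ∈ U) (a : Fin n) :
    ∑ s, (kerrSchild G H k x)⁻¹ a s * lower G k x s = k x a := by
  simp only [← D.lower_kerrSchild hx]
  exact inv_contract_contract (D.isUnit_det_kerrSchild hx) (k x) a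

theorem kerrSchild_inv_symm (D : IsKerrSchildData U G H k) (a b : Fin n) :
    (kerrSchild G H k x)⁻¹ a b = (kerrSchild G H k x)⁻¹ b a := by
  have := Matrix.transpose_nonsing_inv (kerrSchild G H k x)
  rw [(D.kerrSchild_symm x).eq] at this
  conv_lhs => rw [← this, Matrix.transpose_apply]

/-- The Kerr–Schild deformation does not change the volume form, so its difference tensor is
trace-free. -/
theorem sum_connDiff_trace (D : IsKerrSchildData U G H k) (hx : x ∈ U) (b : Fin n) :
    ∑ a, connDiff G H k a a b x = 0 := by
  set gi := (kerrSchild G H k x)⁻¹ with hgi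
  set κ := lower G k x
  have hκ : ∀ a, ∑ s, gi a s * κ s = k x a := D.sum_kerrSchild_inv_mul_lower hx
  have h0 : ∑ a, κ a * k x a = 0 := D.lower_null hx
  have h1 : ∑ a, covDeriv G k a b x * k x a = 0 := D.sum_covDeriv_mul hx b
  have hsym : ∀ a s, gi a s = gi s a := D.kerrSchild_inv_symm
  have e1 : ∑ a, connDiff G H k a a b x = ∑ a, ∑ s, gi a s * connDiffLower G H k s a b x :=
    sum_congr rfl fun a _ => D.connDiff_eq_sum hx a a b
  have e2 : ∑ a, connDiff G H k a a b x = ∑ a, ∑ s, gi a s * connDiffLower G H k a s b x := by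
    rw [e1, sum_comm]
    exact sum_congr rfl fun a _ => sum_congr rfl fun s _ => by rw [hsym]
  -- Averaging over the two orders of the contracted indices symmetrizes `C_{sab}` in `s, a`, which
  -- leaves the covariant derivative of `H κ_s κ_a` alone.
  have e3 : ∑ a, connDiff G H k a a b x + ∑ a, connDiff G H k a a b x =
      -2 * (pderiv b H x * ∑ a, κ a * ∑ s, gi a s * κ s
        + 2 * H x * ∑ a, covDeriv G k a b x * ∑ s, gi a s * κ s) := by
    have : ∑ a, ∑ s, gi a s * (κ a * covDeriv G k s b x) =
        ∑ a, ∑ s, gi a s * (κ s * covDeriv G k a b x) := by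
      rw [sum_comm]
      exact sum_congr rfl fun a _ => sum_congr rfl fun s _ => by rw [hsym]
    calc _ = ∑ a, ∑ s, (-2 * pderiv b H x * (gi a s * (κ a * κ s))
          - 2 * H x * (gi a s * (κ a * covDeriv G k s b x))
          - 2 * H x * (gi a s * (κ s * covDeriv G k a b x))) := by
          nth_rewrite 1 [e1]
          rw [e2, ← sum_add_distrib]
          refine sum_congr rfl fun a _ => ?_
          rw [← sum_add_distrib]
          refine sum_congr rfl fun s _ => ?_
          simp only [connDiffLower]
          ring
      _ = -2 * pderiv b H x * (∑ a, ∑ s, gi a s * (κ a * κ s))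
          - 2 * H x * (∑ a, ∑ s, gi a s * (κ a * covDeriv G k s b x))
          - 2 * H x * (∑ a, ∑ s, gi a s * (κ s * covDeriv G k a b x)) := by
          simp only [mul_sum, ← sum_sub_distrib]
      _ = -2 * (pderiv b H x * (∑ a, ∑ s, gi a s * (κ a * κ s))
          + 2 * H x * (∑ a, ∑ s, gi a s * (κ s * covDeriv G k a b x))) := by
          rw [this]; ring
      _ = _ := by
          simp only [mul_sum]
          congr 2 <;> exact sum_congr rfl fun a _ => sum_congr rfl fun s _ => by ring
  simp only [hκ, h0, h1] at e3
  linarith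

theorem sum_covDerivVec_mul_orthogonal (D : IsKerrSchildData U G H k) (hx : x ∈ U) :
    ∑ c, lower G k x c * ∑ b, covDerivVec G k c b x * k x b = 0 := by
  simp only [mul_sum]
  rw [sum_comm]
  refine sum_eq_zero fun b _ => ?_
  have := D.sum_lower_mul_covDerivVec hx b
  calc _ = k x b * ∑ c, lower G k x c * covDerivVec G k c b x := by
        rw [mul_sum]; exact sum_congr rfl fun a _ => by ring
    _ = 0 := by rw [this, mul_zero]

theorem acceleration_eq_sum (D : IsKerrSchildData U G H k) (hx : x ∈ U) (a : Fin n) :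
    acceleration G k x a = ∑ c, G x a c * ∑ b, covDerivVec G k c b x * k x b := by
  simp only [acceleration, D.covDeriv_eq_sum hx, mul_sum, sum_mul]
  rw [sum_comm]
  exact sum_congr rfl fun b _ => sum_congr rfl fun c _ => by ring

/-- The two metrics raise the acceleration to the same vector `k^b ∇_b k^a`. -/
theorem sum_kerrSchild_inv_mul_acceleration (D : IsKerrSchildData U G H k) (hx : x ∈ U)
    (a : Fin n) :
    ∑ s, (kerrSchild G H k x)⁻¹ a s * acceleration G k x s =
      ∑ b, covDerivVec G k a b x * k x b := by
  simp only [D.acceleration_eq_sum hx,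
    ← sum_kerrSchild_mul_eq (H := H) (D.sum_covDerivVec_mul_orthogonal hx)]
  exact inv_contract_contract (D.isUnit_det_kerrSchild hx) _ a

/-- Since `k^a k_{a;b} = 0`, contracting the difference tensor with `k` kills every term in which
`k` meets another factor `k_a` or the first index of `k_{a;b}`. -/
theorem sum_connDiff_mul (D : IsKerrSchildData U G H k) (hx : x ∈ U) (a b : Fin n) :
    ∑ c, connDiff G H k a b c x * k x c =
      -((∑ c, pderiv c H x * k x c) * k x a * lower G k x b
        + H x * (∑ c, covDerivVec G k a c x * k x c) * lower G k x b
        + H x * k x a * acceleration G k x b) := by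
  have e : ∀ s, ∑ c, connDiffLower G H k s b c x * k x c =
      -((∑ c, pderiv c H x * k x c) * lower G k x b * lower G k x s
        + H x * lower G k x b * acceleration G k x s
        + H x * acceleration G k x b * lower G k x s) := by
    intro s
    have h0 := D.lower_null hx
    have h1 := D.sum_covDeriv_mul hx b
    have h2 := D.sum_covDeriv_mul hx s
    have : ∑ c, connDiffLower G H k s b c x * k x c =
      -((∑ c, pderiv c H x * k x c) * lower G k x b * lower G k x s
        + H x * lower G k x b * (∑ c, covDeriv G k s c x * k x c)
        + H x * (∑ c, covDeriv G k b c x * k x c) * lower G k x s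
        + (pderiv b H x * lower G k x s + H x * covDeriv G k s b x
            - pderiv s H x * lower G k x b - H x * covDeriv G k b s x) *
          (∑ c, lower G k x c * k x c)
        + H x * lower G k x s * (∑ c, covDeriv G k c b x * k x c)
        - H x * lower G k x b * (∑ c, covDeriv G k c s x * k x c)) := by
      simp only [mul_sum, sum_mul, ← sum_add_distrib, ← sum_sub_distrib, ← sum_neg_distrib]
      exact sum_congr rfl fun c _ => by rw [connDiffLower]; ring
    rw [this, h0, h1, h2]
    simp only [acceleration]
    ring
  have e2 : ∑ c, connDiff G H k a b c x * k x c =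
      ∑ s, (kerrSchild G H k x)⁻¹ a s * ∑ c, connDiffLower G H k s b c x * k x c := by
    simp only [D.connDiff_eq_sum hx, mul_sum, sum_mul]
    rw [sum_comm]
    exact sum_congr rfl fun b _ => sum_congr rfl fun c _ => by ring
  rw [e2, ← D.sum_kerrSchild_inv_mul_acceleration hx, ← D.sum_kerrSchild_inv_mul_lower hx a]
  generalize (∑ c, pderiv c H x * k x c) = dH at e ⊢
  simp only [e, mul_sum, sum_mul, ← sum_add_distrib, ← sum_neg_distrib]
  exact sum_congr rfl fun s _ => by ring

/-! ### The difference of the Ricci forms -/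

theorem differentiableAt_connDiff (D : IsKerrSchildData U G H k) (hx : x ∈ U) (a b c : Fin n) :
    DifferentiableAt ℝ (connDiff G H k a b c) x :=
  (differentiableAt_christoffel (D.contDiffAt_kerrSchild hx) (D.isUnit_det_kerrSchild hx) a b c).sub
    (differentiableAt_christoffel (D.contDiffAt_metric x hx) (D.isUnit_det x hx) a b c)

theorem sum_connDiff_mul_lower (D : IsKerrSchildData U G H k) (hx : x ∈ U) (b : Fin n) :
    ∑ a, (∑ c, connDiff G H k a b c x * k x c) * lower G k x a = 0 := by
  have h0 := D.lower_null hx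
  have h1 := D.sum_covDerivVec_mul_orthogonal hx
  have : ∑ a, (∑ c, connDiff G H k a b c x * k x c) * lower G k x a =
      -(((∑ c, pderiv c H x * k x c) * lower G k x b + H x * acceleration G k x b)
          * (∑ a, lower G k x a * k x a)
        + H x * lower G k x b *
          (∑ c, lower G k x c * ∑ b, covDerivVec G k c b x * k x b)) := by
    simp only [D.sum_connDiff_mul hx]
    generalize (∑ c, pderiv c H x * k x c) = dH
    rw [mul_sum, mul_sum, ← sum_add_distrib, ← sum_neg_distrib]
    exact sum_congr rfl fun s _ => by ring
  rw [this, h0, h1]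
  ring

theorem sum_connDiff_mul_mul (D : IsKerrSchildData U G H k) (hx : x ∈ U) (a : Fin n) :
    ∑ b, ∑ c, connDiff G H k a b c x * k x b * k x c = 0 := by
  have h0 := D.lower_null hx
  have h1 := D.sum_acceleration_mul hx
  have : ∑ b, ∑ c, connDiff G H k a b c x * k x b * k x c =
      ∑ b, (∑ c, connDiff G H k a b c x * k x c) * k x b := by
    simp only [sum_mul]
    exact sum_congr rfl fun b _ => sum_congr rfl fun c _ => by ring
  rw [this]
  have : ∑ b, (∑ c, connDiff G H k a b c x * k x c) * k x b =
      -(((∑ c, pderiv c H x * k x c) * k x a + H x * (∑ c, covDerivVec G k a c x * k x c))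
          * (∑ a, lower G k x a * k x a)
        + H x * k x a * (∑ b, acceleration G k x b * k x b)) := by
    simp only [D.sum_connDiff_mul hx]
    generalize (∑ c, pderiv c H x * k x c) = dH
    generalize (∑ c, covDerivVec G k a c x * k x c) = q
    rw [mul_sum, mul_sum, ← sum_add_distrib, ← sum_neg_distrib]
    exact sum_congr rfl fun s _ => by ring
  rw [this, h0, h1]
  ring

/-- Differentiating `C^a_{bc} k^b k^c = 0`. -/
theorem sum_pderiv_connDiff (D : IsKerrSchildData U G H k) (hx : x ∈ U) (a e : Fin n) :
    ∑ b, ∑ c, pderiv e (connDiff G H k a b c) x * k x b * k x c =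
      -2 * ∑ b, (∑ c, connDiff G H k a b c x * k x c) * pderiv e (fun y => k y b) x := by
  have hk := fun a => (D.contDiffAt_vector x hx a).differentiableAt (by norm_num)
  have hC := D.differentiableAt_connDiff hx a
  have h0 : pderiv e (fun y => ∑ b, ∑ c, connDiff G H k a b c y * k y b * k y c) x = 0 := by
    rw [pderiv_congr D.isOpen hx (fun y hy => D.sum_connDiff_mul_mul hy a) e, pderiv_const]
  have h1 : pderiv e (fun y => ∑ b, ∑ c, connDiff G H k a b c y * k y b * k y c) x =
      ∑ b, ∑ c, (connDiff G H k a b c x * k x b * pderiv e (fun y => k y c) x +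
        (connDiff G H k a b c x * pderiv e (fun y => k y b) x
          + pderiv e (connDiff G H k a b c) x * k x b) * k x c) := by
    rw [pderiv_sum _ _ fun b => DifferentiableAt.fun_sum fun c _ =>
      ((hC b c).fun_mul (hk b)).fun_mul (hk c)]
    refine sum_congr rfl fun b _ => ?_
    rw [pderiv_sum_mul e (fun c => (hC b c).fun_mul (hk b)) hk]
    exact sum_congr rfl fun c _ => by rw [pderiv_mul e (hC b c) (hk b)]
  have h2 : ∑ b, ∑ c, connDiff G H k a b c x * k x b * pderiv e (fun y => k y c) x =
      ∑ b, ∑ c, connDiff G H k a b c x * k x c * pderiv e (fun y => k y b) x := by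
    rw [sum_comm]
    exact sum_congr rfl fun b _ => sum_congr rfl fun c _ => by rw [D.connDiff_symm a c b]
  have h3 : ∑ b, ∑ c, connDiff G H k a b c x * pderiv e (fun y => k y b) x * k x c =
      ∑ b, ∑ c, connDiff G H k a b c x * k x c * pderiv e (fun y => k y b) x :=
    sum_congr rfl fun b _ => sum_congr rfl fun c _ => by ring
  simp only [sum_add_distrib, add_mul, h2, h3] at h1
  simp only [sum_mul]
  linarith

theorem sum_pderiv_christoffel_trace (D : IsKerrSchildData U G H k) (hx : x ∈ U) (b c : Fin n) :
    ∑ a, pderiv c (christoffel (kerrSchild G H k) a b a) x =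
      ∑ a, pderiv c (christoffel G a b a) x := by
  rw [← pderiv_sum univ c fun a => differentiableAt_christoffel (D.contDiffAt_kerrSchild hx)
    (D.isUnit_det_kerrSchild hx) a b a, ← pderiv_sum univ c fun a =>
    differentiableAt_christoffel (D.contDiffAt_metric x hx) (D.isUnit_det x hx) a b a]
  refine pderiv_congr D.isOpen hx (fun y hy => ?_) c
  rw [← sub_eq_zero, ← sum_sub_distrib, ← D.sum_connDiff_trace hy b]
  exact sum_congr rfl fun a _ => D.connDiff_symm a b a

/-- No derivative of the difference tensor is left: those in the trace terms vanish, and the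
remaining one has been moved onto `k`, where it completes the covariant derivative. -/
theorem contract_ricci_sub (D : IsKerrSchildData U G H k) (hx : x ∈ U) :
    contract (ricci (kerrSchild G H k)) x (k x) (k x) - contract (ricci G) x (k x) (k x) =
      -2 * ∑ a, ∑ b, (∑ c, connDiff G H k a b c x * k x c) * covDerivVec G k b a x
      - ∑ a, ∑ b, (∑ c, connDiff G H k a b c x * k x c) *
          ∑ c, connDiff G H k b a c x * k x c := by
  have hΓ : ∀ a b c, christoffel (kerrSchild G H k) a b c x =
      christoffel G a b c x + connDiff G H k a b c x := fun a b c => by rw [connDiff]; ring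
  have hdΓ : ∀ a b c e, pderiv e (christoffel (kerrSchild G H k) a b c) x =
      pderiv e (christoffel G a b c) x + pderiv e (connDiff G H k a b c) x := by
    intro a b c e
    rw [← pderiv_add e
      (differentiableAt_christoffel (D.contDiffAt_metric x hx) (D.isUnit_det x hx) a b c)
      (D.differentiableAt_connDiff hx a b c)]
    congr 1
    funext y
    rw [connDiff]; ring
  have e1 : ∑ a, ∑ b, ∑ c, pderiv a (christoffel (kerrSchild G H k) a b c) x * k x b * k x c =
      ∑ a, ∑ b, ∑ c, pderiv a (christoffel G a b c) x * k x b * k x c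
      - 2 * ∑ a, ∑ b, (∑ c, connDiff G H k a b c x * k x c) * pderiv a (fun y => k y b) x := by
    simp only [hdΓ, add_mul, sum_add_distrib, D.sum_pderiv_connDiff hx]
    rw [← mul_sum]
    ring
  have e3 : ∀ d, (∑ a, christoffel (kerrSchild G H k) a a d x) *
      (∑ b, ∑ c, christoffel (kerrSchild G H k) d b c x * k x b * k x c) =
      (∑ a, christoffel G a a d x) *
      (∑ b, ∑ c, christoffel G d b c x * k x b * k x c) := by
    intro d
    simp only [hΓ, add_mul, sum_add_distrib, D.sum_connDiff_trace hx, D.sum_connDiff_mul_mul hx,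
      add_zero]
  have e4 : ∑ a, ∑ d, (∑ c, christoffel (kerrSchild G H k) a d c x * k x c) *
        (∑ b, christoffel (kerrSchild G H k) d a b x * k x b) =
      ∑ a, ∑ d, (∑ c, christoffel G a d c x * k x c) * (∑ b, christoffel G d a b x * k x b)
      + 2 * ∑ a, ∑ b, (∑ c, connDiff G H k a b c x * k x c) *
          (∑ d, christoffel G b a d x * k x d)
      + ∑ a, ∑ b, (∑ c, connDiff G H k a b c x * k x c) *
          ∑ c, connDiff G H k b a c x * k x c := by
    have : ∑ a, ∑ b, (∑ c, connDiff G H k a b c x * k x c) *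
          (∑ d, christoffel G b a d x * k x d) =
        ∑ a, ∑ b, (∑ d, christoffel G a b d x * k x d) *
          (∑ c, connDiff G H k b a c x * k x c) := by
      rw [sum_comm]
      exact sum_congr rfl fun a _ => sum_congr rfl fun b _ => mul_comm _ _
    simp only [hΓ, add_mul, mul_add, sum_add_distrib]
    linarith
  rw [contract_ricci D.kerrSchild_symm, contract_ricci D.symm, e1, e4]
  simp only [e3, D.sum_pderiv_christoffel_trace hx, covDerivVec, mul_add, sum_add_distrib]
  ring

/-- The null-null Ricci component of a Kerr–Schild metric over an arbitrary background. Of the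
terms in `contract_ricci_sub` the quadratic one vanishes, as `k` is null and orthogonal to `A`; the
linear one keeps only the product of `H k^a A_b` with `∇_a k^b`. -/
theorem contract_ricci_kerrSchild (D : IsKerrSchildData U G H k) (hx : x ∈ U) :
    contract (ricci (kerrSchild G H k)) x (k x) (k x) = contract (ricci G) x (k x) (k x) +
      2 * H x * ∑ a, ∑ b, (G x)⁻¹ a b * acceleration G k x a * acceleration G k x b := by
  have hinv : ∀ a, ∑ b, covDerivVec G k a b x * k x b =
      ∑ s, (G x)⁻¹ a s * acceleration G k x s := by
    intro a
    simp only [D.acceleration_eq_sum hx]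
    exact (inv_contract_contract (D.isUnit_det x hx)
      (fun c => ∑ b, covDerivVec G k c b x * k x b) a).symm
  set A := acceleration G k x
  set V : Fin n → ℝ := fun a => ∑ b, covDerivVec G k a b x * k x b with hV
  set κ := lower G k x
  have hM : ∀ a b, ∑ c, connDiff G H k a b c x * k x c = -((∑ c, pderiv c H x * k x c) * k x a * κ b
      + H x * V a * κ b + H x * k x a * A b) := D.sum_connDiff_mul hx
  generalize (∑ c, pderiv c H x * k x c) = dH at hM
  have h1 : ∀ b, ∑ a, (∑ c, connDiff G H k a b c x * k x c) * κ a = 0 :=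
    D.sum_connDiff_mul_lower hx
  have h2 : ∀ b, ∑ c, κ c * covDerivVec G k c b x = 0 := D.sum_lower_mul_covDerivVec hx
  have h3 : ∑ a, A a * k x a = 0 := D.sum_acceleration_mul hx
  have h4 : ∀ a, ∑ b, (∑ c, connDiff G H k a b c x * k x c) * k x b = 0 := by
    intro a
    rw [← D.sum_connDiff_mul_mul hx a]
    simp only [sum_mul]
    exact sum_congr rfl fun b _ => sum_congr rfl fun c _ => by ring
  have f1 : ∑ a, ∑ b, (∑ c, connDiff G H k a b c x * k x c) * covDerivVec G k b a x =
      -H x * ∑ a, V a * A a := by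
    have : ∑ a, ∑ b, (∑ c, connDiff G H k a b c x * k x c) * covDerivVec G k b a x =
        -(∑ a, (dH * k x a + H x * V a) * ∑ b, κ b * covDerivVec G k b a x)
        - H x * ∑ b, (∑ a, covDerivVec G k b a x * k x a) * A b := by
      have : ∑ b, (∑ a, covDerivVec G k b a x * k x a) * A b =
          ∑ a, ∑ b, covDerivVec G k b a x * k x a * A b := by
        simp only [sum_mul]
        rw [sum_comm]
      rw [this]
      simp only [mul_sum, hM, ← sum_sub_distrib, ← sum_neg_distrib]
      exact sum_congr rfl fun a _ => sum_congr rfl fun b _ => by ring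
    rw [this]
    simp only [h2, mul_zero, sum_const_zero, hV]
    ring
  have f2 : ∑ a, ∑ b, (∑ c, connDiff G H k a b c x * k x c) *
      ∑ c, connDiff G H k b a c x * k x c = 0 := by
    have : ∀ a, ∑ b, (∑ c, connDiff G H k a b c x * k x c) *
        (∑ c, connDiff G H k b a c x * k x c) =
        -(dH * κ a + H x * A a) * (∑ b, (∑ c, connDiff G H k a b c x * k x c) * k x b)
        - H x * κ a * ∑ b, (∑ c, connDiff G H k a b c x * k x c) * V b := by
      intro a
      simp only [hM _ a, mul_sum (s := univ) (a := -(dH * κ a + H x * A a)),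
        mul_sum (s := univ) (a := H x * κ a), ← sum_sub_distrib]
      exact sum_congr rfl fun b _ => by ring
    simp only [this, h4]
    have e : ∑ a, H x * κ a * ∑ b, (∑ c, connDiff G H k a b c x * k x c) * V b =
        H x * ∑ b, V b * ∑ a, (∑ c, connDiff G H k a b c x * k x c) * κ a := by
      have : ∀ a, H x * κ a * ∑ b, (∑ c, connDiff G H k a b c x * k x c) * V b =
          ∑ b, H x * V b * ((∑ c, connDiff G H k a b c x * k x c) * κ a) := by
        intro a
        rw [mul_sum]
        exact sum_congr rfl fun b _ => by ring
      simp only [this]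
      rw [sum_comm, mul_sum]
      simp only [← mul_sum, mul_assoc]
    simp only [h1, mul_zero, sum_const_zero] at e
    simp only [mul_zero, zero_sub, sum_neg_distrib, e, neg_zero]
  have f3 : ∑ a, V a * A a = ∑ a, ∑ b, (G x)⁻¹ a b * A a * A b := by
    simp only [hV, hinv, sum_mul]
    exact sum_congr rfl fun a _ => sum_congr rfl fun b _ => by ring
  have := D.contract_ricci_sub hx
  rw [f1, f2, f3] at this
  linarith

/-- Background and Kerr–Schild metric assign the same acceleration to `k`. -/
theorem acceleration_kerrSchild (D : IsKerrSchildData U G H k) (hx : x ∈ U) (a : Fin n) :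
    acceleration (kerrSchild G H k) k x a = acceleration G k x a := by
  have h : ∀ b, covDeriv (kerrSchild G H k) k a b x = covDeriv G k a b x
      - ∑ c, connDiff G H k c a b x * lower G k x c := by
    intro b
    simp only [covDeriv, D.lower_kerrSchild hx, connDiff, sub_mul, sum_sub_distrib]
    rw [pderiv_congr D.isOpen hx (fun y hy => D.lower_kerrSchild hy a) b]
    ring
  have h2 := D.sum_connDiff_mul_lower hx a
  simp only [acceleration, h, sub_mul, sum_sub_distrib]
  have : ∑ b, (∑ c, connDiff G H k c a b x * lower G k x c) * k x b = 0 := by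
    rw [← h2]
    simp only [sum_mul]
    rw [sum_comm]
    exact sum_congr rfl fun b _ => sum_congr rfl fun c _ => by ring
  rw [this, sub_zero]

end IsKerrSchildData

/-! ### Null frames -/

theorem fin_one_val (hn : 2 ≤ n) [NeZero n] : (1 : Fin n).val = 1 := by
  rw [Fin.val_one', Nat.mod_eq_of_lt (by omega)]

theorem isNullFrame_gram_eq (hn : 2 ≤ n) [NeZero n] (c d : Fin n) :
    (if (c.val = 0 ∧ d.val = 1) ∨ (c.val = 1 ∧ d.val = 0) ∨ (2 ≤ c.val ∧ c = d)
      then (1 : ℝ) else 0) = if d = Equiv.swap 0 1 c then 1 else 0 := by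
  have h1 := fin_one_val hn
  have h0 : (0 : Fin n).val = 0 := rfl
  congr 1
  rw [Equiv.swap_apply_def]
  split_ifs with hc hc'
  · have hd : d = 1 ↔ d.val = 1 := ⟨fun h => h ▸ h1, fun h => Fin.ext (h.trans h1.symm)⟩
    have hc0 : c.val = 0 := hc ▸ h0
    rw [eq_iff_iff, hd]
    omega
  · have hd : d = 0 ↔ d.val = 0 := ⟨fun h => h ▸ h0, fun h => Fin.ext (h.trans h0.symm)⟩
    have hc1 : c.val = 1 := hc' ▸ h1
    rw [eq_iff_iff, hd]
    omega
  · have e0 : c.val ≠ 0 := fun h => hc (Fin.ext (by simp [h]))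
    have e1 : c.val ≠ 1 := fun h => hc' (Fin.ext (h.trans h1.symm))
    simp only [Fin.ext_iff, eq_iff_iff]
    omega

/-- A null frame `m` turns the norm of a covector orthogonal to `m 1` into a sum of squares. This
is `g^{ab} = ∑ N^{cd} m_c^a m_d^b`, where the Gram matrix `N` of the frame is its own inverse: it is
the permutation matrix of the transposition of `0` and `1`. -/
theorem IsNullFrame.sum_inv_mul_mul (hn : 2 ≤ n) [NeZero n] {g : TensorField n} {x : Coord n}
    {m : Fin n → Fin n → ℝ} (hm : IsNullFrame g x m) {A : Fin n → ℝ} (hA : ∑ a, A a * m 1 a = 0) :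
    ∑ a, ∑ b, (g x)⁻¹ a b * A a * A b = ∑ i : Fin n with 2 ≤ i.val, (∑ a, A a * m i a) ^ 2 := by
  set σ : Equiv.Perm (Fin n) := Equiv.swap 0 1 with hσ
  set P : Matrix (Fin n) (Fin n) ℝ := Matrix.of m with hP
  set N : Matrix (Fin n) (Fin n) ℝ := Matrix.of fun c d => if d = σ c then 1 else 0 with hN
  have hσσ : ∀ c, σ (σ c) = c := fun c => Equiv.swap_apply_self 0 1 c
  have hPN : P * g x * P.transpose = N := by
    ext c d
    have := hm c d
    rw [isNullFrame_gram_eq hn] at this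
    rw [hN, Matrix.of_apply, ← this, Matrix.mul_apply]
    simp only [Matrix.mul_apply, contract, hP, Matrix.of_apply, Matrix.transpose_apply, sum_mul]
    rw [sum_comm]
    exact sum_congr rfl fun a _ => sum_congr rfl fun b _ => by ring
  have hNN : N * N = 1 := by
    ext c d
    simp only [hN, Matrix.mul_apply, Matrix.of_apply, Matrix.one_apply, ite_mul, one_mul, zero_mul,
      sum_ite_eq', mem_univ, if_true, hσσ, eq_comm]
  have hinv : (g x)⁻¹ = P.transpose * N * P := by
    refine Matrix.inv_eq_right_inv ?_
    have h1 : P * (g x * P.transpose * N) = 1 := by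
      rw [← hNN, ← hPN]; simp only [Matrix.mul_assoc]
    have h2 := mul_eq_one_comm.mp h1
    rw [← h2]; simp only [Matrix.mul_assoc]
  set w : Fin n → ℝ := fun i => ∑ a, A a * m i a with hw
  have e1 : ∑ a, ∑ b, (g x)⁻¹ a b * A a * A b = ∑ i, w i * w (σ i) := by
    have l : ∑ a, ∑ b, (g x)⁻¹ a b * A a * A b = dotProduct A ((g x)⁻¹.mulVec A) := by
      simp only [dotProduct, Matrix.mulVec, mul_sum]
      exact sum_congr rfl fun a _ => sum_congr rfl fun b _ => by ring
    have hPw : P.mulVec A = w := by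
      funext i
      simp only [Matrix.mulVec, dotProduct, hw, hP, Matrix.of_apply]
      exact sum_congr rfl fun a _ => mul_comm _ _
    rw [l, hinv, ← Matrix.mulVec_mulVec, ← Matrix.mulVec_mulVec, Matrix.dotProduct_mulVec,
      Matrix.vecMul_transpose, hPw]
    simp only [dotProduct, Matrix.mulVec, hN, Matrix.of_apply, ite_mul, one_mul, zero_mul,
      sum_ite_eq', mem_univ, if_true]
  have hw1 : w 1 = 0 := hA
  have h1 := fin_one_val hn
  rw [e1, sum_filter]
  refine sum_congr rfl fun i _ => ?_
  rw [hσ, Equiv.swap_apply_def]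
  split_ifs with hi0 hi2 hi1 hi2 hi2
  · simp [hi0] at hi2
  · rw [hw1, mul_zero]
  · rw [hi1, h1] at hi2; omega
  · rw [hi1, hw1, zero_mul]
  · rw [sq]
  · have e0 : i.val ≠ 0 := fun h => hi0 (Fin.ext (by simp [h]))
    have e1 : i.val ≠ 1 := fun h => hi1 (Fin.ext (h.trans h1.symm))
    omega

/-! ### Ricci curvature of conformally flat metrics -/

/-- Connection of a conformally flat metric `Ω η` with `η` diagonal, `η² = 1`: here `φ` is half the
logarithmic gradient of `Ω`. -/
theorem christoffel_conformal {e : Fin n → ℝ} (he : ∀ a, e a * e a = 1) {Ω : Coord n → ℝ}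
    {φ : Fin n → Coord n → ℝ} {x : Coord n} (hd : DifferentiableAt ℝ Ω x) (h0 : Ω x ≠ 0)
    (hφ : ∀ c, pderiv c Ω x = 2 * φ c x * Ω x) (a b c : Fin n) :
    christoffel (fun y => Ω y • Matrix.diagonal e) a b c x =
      (if a = b then φ c x else 0) + (if a = c then φ b x else 0)
        - (if b = c then e b else 0) * (e a * φ a x) := by
  have hinv : (Ω x • Matrix.diagonal e)⁻¹ = (Ω x)⁻¹ • Matrix.diagonal e := by
    refine Matrix.inv_eq_right_inv ?_
    rw [Matrix.smul_mul, Matrix.mul_smul, smul_smul, mul_inv_cancel₀ h0, one_smul,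
      Matrix.diagonal_mul_diagonal]
    simp [he]
  have hp : ∀ c a b, pderiv c (fun y => (Ω y • Matrix.diagonal e) a b) x =
      2 * φ c x * Ω x * (Matrix.diagonal e a b) := by
    intro c a b
    rw [← hφ c]
    simp only [Matrix.smul_apply, smul_eq_mul]
    rw [pderiv_mul c hd (differentiableAt_const _), pderiv_const]
    ring
  simp only [christoffel, hp, hinv]
  simp only [Matrix.smul_apply, Matrix.diagonal_apply, smul_eq_mul, mul_ite, mul_zero, ite_mul,
    zero_mul, sum_ite_eq, mem_univ, if_true]
  have hm := he a
  by_cases hab : a = b <;> by_cases hac : a = c <;> by_cases hbc : b = c <;>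
    simp only [hab, hac, hbc, if_true, if_false] <;> field_simp <;> grind

/-- Contraction of symbols of the shape in `christoffel_conformal` with a null vector `v`. -/
theorem sum_sum_conformal {e : Fin n → ℝ} {v : Fin n → ℝ} (hv : ∑ b, e b * v b * v b = 0)
    (p : Fin n → ℝ) (r : ℝ) (a : Fin n) :
    ∑ b, ∑ c, ((if a = b then p c else 0) + (if a = c then p b else 0)
      - (if b = c then e b else 0) * r) * v b * v c = 2 * v a * ∑ c, p c * v c := by
  have h1 : ∑ b, ∑ c, (if a = b then p c else 0) * v b * v c = v a * ∑ c, p c * v c := by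
    simp only [ite_mul, zero_mul, mul_sum]
    rw [sum_comm]
    simp only [sum_ite_eq, mem_univ, if_true]
    exact sum_congr rfl fun c _ => by ring
  have h2 : ∑ b, ∑ c, (if a = c then p b else 0) * v b * v c = v a * ∑ c, p c * v c := by
    simp only [ite_mul, zero_mul, mul_sum, sum_ite_eq, mem_univ, if_true]
    exact sum_congr rfl fun c _ => by ring
  have h3 : ∑ b, ∑ c, (if b = c then e b else 0) * r * v b * v c =
      r * ∑ b, e b * v b * v b := by
    simp only [ite_mul, zero_mul, mul_sum, sum_ite_eq, mem_univ, if_true]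
    exact sum_congr rfl fun c _ => by ring
  rw [hv] at h3
  simp only [add_mul, sub_mul, sum_add_distrib, sum_sub_distrib, h1, h2, h3]
  ring

/-- If half the logarithmic gradient `φ` of `Ω` satisfies `∂_b φ_c = φ_b φ_c`, then `Ω η` is an
Einstein metric; this is the consequence that its Ricci tensor vanishes on null vectors. -/
theorem contract_ricci_conformal {e : Fin n → ℝ} (he : ∀ a, e a * e a = 1) {Ω : Coord n → ℝ}
    {φ : Fin n → Coord n → ℝ} {U : Set (Coord n)} (hU : IsOpen U)
    (hd : ∀ x ∈ U, DifferentiableAt ℝ Ω x) (h0 : ∀ x ∈ U, Ω x ≠ 0)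
    (hφd : ∀ x ∈ U, ∀ c, DifferentiableAt ℝ (φ c) x)
    (hφ : ∀ x ∈ U, ∀ c, pderiv c Ω x = 2 * φ c x * Ω x)
    (hφφ : ∀ x ∈ U, ∀ b c, pderiv b (φ c) x = φ b x * φ c x)
    {x : Coord n} (hx : x ∈ U) {v : Fin n → ℝ} (hv : ∑ b, e b * v b * v b = 0) :
    contract (ricci fun y => Ω y • Matrix.diagonal e) x v v = 0 := by
  have hΓ := fun y (hy : y ∈ U) => christoffel_conformal he (hd y hy) (h0 y hy) (hφ y hy)
  have hdΓ : ∀ a b c d, pderiv d (christoffel (fun y => Ω y • Matrix.diagonal e) a b c) x =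
      (if a = b then φ d x * φ c x else 0) + (if a = c then φ d x * φ b x else 0)
        - (if b = c then e b else 0) * (e a * (φ d x * φ a x)) := by
    intro a b c d
    have hi : ∀ (p : Prop) [Decidable p] (c : Fin n),
        DifferentiableAt ℝ (fun y => if p then φ c y else 0) x := by
      intro p _ c
      split_ifs
      · exact hφd x hx c
      · exact differentiableAt_const _
    have hpi : ∀ (p : Prop) [Decidable p] (c : Fin n),
        pderiv d (fun y => if p then φ c y else 0) x = if p then φ d x * φ c x else 0 := by
      intro p _ c
      split_ifs
      · exact hφφ x hx d c
      · exact pderiv_const _ _ _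
    rw [pderiv_congr hU hx (fun y hy => hΓ y hy a b c) d,
      pderiv_sub d ((hi _ c).fun_add (hi _ b)) (((hφd x hx a).const_mul _).const_mul _),
      pderiv_add d (hi _ c) (hi _ b), pderiv_const_mul d _ ((hφd x hx a).const_mul _),
      pderiv_const_mul d _ (hφd x hx a), hpi, hpi, hφφ x hx]
  have hsymm : ∀ y, (Ω y • Matrix.diagonal e).IsSymm := fun y =>
    (Matrix.isSymm_diagonal e).smul (Ω y)
  set u := ∑ c, φ c x * v c with hu
  have e1 : ∑ a, ∑ b, ∑ c, pderiv a (christoffel (fun y => Ω y • Matrix.diagonal e) a b c) x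
      * v b * v c = 2 * u ^ 2 := by
    have : ∀ a, ∑ c, φ a x * φ c x * v c = φ a x * u := fun a => by
      rw [hu, mul_sum]; exact sum_congr rfl fun c _ => by ring
    simp only [hdΓ, sum_sum_conformal hv (fun c => φ _ x * φ c x), this]
    calc _ = 2 * u * ∑ a, φ a x * v a := by
          rw [mul_sum]; exact sum_congr rfl fun a _ => by ring
      _ = _ := by rw [← hu]; ring
  -- Two of the three terms of `Γ^a_{ba}` cancel for each `a` separately.
  have htr : ∀ a b (p : ℝ),
      (if a = b then p else 0) - (if b = a then e b else 0) * (e a * p) = 0 := by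
    intro a b p
    by_cases hab : a = b
    · subst hab
      simp only [if_true]
      linear_combination -p * he a
    · simp [hab, Ne.symm hab]
  have e2 : ∑ b, ∑ c, (∑ a, pderiv c (christoffel (fun y => Ω y • Matrix.diagonal e) a b a) x)
      * v b * v c = n * u ^ 2 := by
    have : ∀ a b c, pderiv c (christoffel (fun y => Ω y • Matrix.diagonal e) a b a) x =
        φ c x * φ b x := by
      intro a b c
      rw [hdΓ, if_pos rfl]
      linear_combination htr a b (φ c x * φ a x)
    simp only [this, sum_const, card_univ, Fintype.card_fin, nsmul_eq_mul]
    rw [sq, hu, sum_mul_sum, mul_sum]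
    refine sum_congr rfl fun b _ => ?_
    rw [mul_sum]
    exact sum_congr rfl fun c _ => by ring
  have e3 : ∑ d, (∑ a, christoffel (fun y => Ω y • Matrix.diagonal e) a a d x) *
      ∑ b, ∑ c, christoffel (fun y => Ω y • Matrix.diagonal e) d b c x * v b * v c =
      2 * n * u ^ 2 := by
    have : ∀ a d, christoffel (fun y => Ω y • Matrix.diagonal e) a a d x = φ d x := by
      intro a d
      rw [christoffel_symm hsymm, hΓ x hx, if_pos rfl]
      linear_combination htr a d (φ a x)
    simp only [this]
    simp only [hΓ x hx, sum_sum_conformal hv (fun c => φ c x), sum_const, card_univ,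
      Fintype.card_fin, nsmul_eq_mul, ← hu]
    calc _ = 2 * n * u * ∑ a, φ a x * v a := by
          rw [mul_sum]; exact sum_congr rfl fun a _ => by ring
      _ = _ := by rw [← hu]; ring
  have e4 : ∑ a, ∑ d, (∑ c, christoffel (fun y => Ω y • Matrix.diagonal e) a d c x * v c) *
      (∑ b, christoffel (fun y => Ω y • Matrix.diagonal e) d a b x * v b) = (n + 2) * u ^ 2 := by
    have hN : ∀ a d, ∑ c, christoffel (fun y => Ω y • Matrix.diagonal e) a d c x * v c =
        (if a = d then u else 0) + v a * φ d x - e d * v d * (e a * φ a x) := by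
      intro a d
      simp only [hΓ x hx, add_mul, sub_mul, ite_mul, zero_mul, sum_add_distrib, sum_sub_distrib,
        sum_ite_eq, mem_univ, if_true]
      by_cases had : a = d
      · simp only [had, if_true, hu]; ring
      · simp only [had, if_false, sum_const_zero]; ring
    have hNN : ∀ a d, ((if a = d then u else 0) + v a * φ d x - e d * v d * (e a * φ a x)) *
        ((if d = a then u else 0) + v d * φ a x - e a * v a * (e d * φ d x)) =
        (if a = d then u ^ 2 else 0) + 2 * (φ a x * v a) * (φ d x * v d)
          - (e a * v a * v a) * (e d * φ d x ^ 2) - (e d * v d * v d) * (e a * φ a x ^ 2) := by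
      intro a d
      by_cases had : a = d
      · subst had
        simp only [if_true]
        linear_combination (-2 * u * v a * φ a x + (v a) ^ 2 * φ a x ^ 2 * (e a * e a + 1)) * he a
      · simp only [had, Ne.symm had, if_false]
        linear_combination v a * φ a x * v d * φ d x * (e d * e d) * he a
          + v a * φ a x * v d * φ d x * he d
    simp only [hN, hNN, sum_sub_distrib, sum_add_distrib, sum_ite_eq, mem_univ, if_true,
      ← mul_sum, ← sum_mul, hv, zero_mul, sum_const_zero, sum_const, card_univ,
      Fintype.card_fin, nsmul_eq_mul, ← hu]
    ring
  rw [contract_ricci hsymm, e1, e2, e3, e4]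
  ring

/-! ### Continuity of the acceleration and the field equations -/

namespace IsKerrSchildData

variable {U : Set (Coord n)} {G : TensorField n} {H : Coord n → ℝ} {k : Coord n → Fin n → ℝ}
  {x : Coord n}

/-- The squared norm of the acceleration of `k` depends continuously on the point. -/
theorem continuousAt_acceleration_sq (D : IsKerrSchildData U G H k) (hx : x ∈ U) :
    ContinuousAt (fun y => ∑ a, ∑ b, (G y)⁻¹ a b * acceleration G k y a * acceleration G k y b)
      x := by
  have hk := fun a => (D.contDiffAt_vector x hx a).differentiableAt (by norm_num)
  have hG := fun a b => (D.contDiffAt_metric x hx a b).differentiableAt (by norm_num)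
  have hA : ∀ a, DifferentiableAt ℝ (fun y => acceleration G k y a) x := fun a =>
    DifferentiableAt.fun_sum fun b _ =>
      ((differentiableAt_pderiv b (D.contDiffAt_lower hx a)).fun_sub
        (DifferentiableAt.fun_sum fun c _ =>
          (differentiableAt_christoffel (D.contDiffAt_metric x hx) (D.isUnit_det x hx) c a
            b).fun_mul (D.differentiableAt_lower hx c))).fun_mul (hk b)
  exact (DifferentiableAt.fun_sum fun a _ => DifferentiableAt.fun_sum fun b _ =>
    ((differentiableAt_inv_apply hG (D.isUnit_det x hx) a b).fun_mul (hA a)).fun_mul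
      (hA b)).continuousAt

theorem contract_kerrSchild_self (D : IsKerrSchildData U G H k) (hx : x ∈ U) :
    contract (kerrSchild G H k) x (k x) (k x) = 0 := by
  rw [contract_self_eq_lower]
  simp only [D.lower_kerrSchild hx, D.lower_null hx]

/-- `R_{ab} k^a k^b` and `8π T_{ab} k^a k^b` agree, the metric terms dropping out. -/
theorem contract_energyMomentum (D : IsKerrSchildData U G H k) (hx : x ∈ U) {Λ' : ℝ}
    {T : TensorField n} (hT : EinsteinEquations U (kerrSchild G H k) Λ' T) :
    contract (ricci (kerrSchild G H k)) x (k x) (k x) =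
      8 * Real.pi * contract T x (k x) (k x) := by
  set g := kerrSchild G H k
  have h0 : contract g x (k x) (k x) = 0 := D.contract_kerrSchild_self hx
  have : 8 * Real.pi * contract T x (k x) (k x) = contract (ricci g) x (k x) (k x)
      + (Λ' - 1 / 2 * scalarCurvature g x) * contract g x (k x) (k x) := by
    simp only [contract, mul_sum, ← sum_add_distrib]
    refine sum_congr rfl fun a _ => sum_congr rfl fun b _ => ?_
    linear_combination -(k x a * k x b) * hT x hx a b
  rw [this, h0, mul_zero, add_zero]

end IsKerrSchildData

theorem rotationL0_eq (g : TensorField n) (k : Coord n → Fin n → ℝ) (x : Coord n)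
    (m : Fin n → ℝ) : rotationL0 g k x m = ∑ a, acceleration g k x a * m a := by
  simp only [rotationL0, acceleration, sum_mul]
  exact sum_congr rfl fun a _ => sum_congr rfl fun b _ => by ring

/-! ### Null covectors orthogonal to a null vector -/

/-- In Minkowski space, a null covector orthogonal to a nonzero null vector is proportional to
it. -/
theorem exists_eq_mul_of_null_of_orthogonal [NeZero n] {e : Fin n → ℝ} (he0 : e 0 = -1)
    (he : ∀ a, a ≠ 0 → e a = 1) {A v : Fin n → ℝ} (hv0 : v ≠ 0)
    (hA : ∑ a, e a * A a * A a = 0) (hv : ∑ a, e a * v a * v a = 0)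
    (hAv : ∑ a, A a * v a = 0) : ∃ μ : ℝ, ∀ a, A a = μ * (e a * v a) := by
  have key : ∀ w : Fin n → ℝ, w 0 = 0 → ∑ a, e a * w a * w a = 0 → ∀ a, w a = 0 := by
    intro w hw0 hw a
    have hnn : ∀ a ∈ univ, 0 ≤ e a * w a * w a := by
      intro a _
      by_cases ha : a = 0
      · simp [ha, hw0]
      · rw [he a ha, one_mul]; exact mul_self_nonneg _
    have := (sum_eq_zero_iff_of_nonneg hnn).mp hw a (mem_univ a)
    by_cases ha : a = 0
    · rw [ha, hw0]
    · rw [he a ha, one_mul] at this; exact mul_self_eq_zero.mp this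
  have hv00 : v 0 ≠ 0 := fun h => hv0 (funext (key v h hv))
  have hee : ∀ a, e a * e a = 1 := fun a => by
    by_cases ha : a = 0
    · rw [ha, he0]; norm_num
    · rw [he a ha]; norm_num
  -- The multiple of `v` that makes the time component of the difference vanish.
  refine ⟨-(A 0 / v 0), fun a => ?_⟩
  have h := key (fun a => A a + A 0 / v 0 * (e a * v a)) (by
    simp only [he0]; field_simp; ring) (by
    have : ∑ a, e a * (A a + A 0 / v 0 * (e a * v a)) * (A a + A 0 / v 0 * (e a * v a)) =
        ∑ a, e a * A a * A a + 2 * (A 0 / v 0) * ∑ a, A a * v a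
          + (A 0 / v 0) ^ 2 * ∑ a, e a * v a * v a := by
      simp only [mul_sum, ← sum_add_distrib]
      refine sum_congr rfl fun a _ => ?_
      linear_combination (2 * (A 0 / v 0) * A a * v a + (A 0 / v 0) ^ 2 * e a * v a * v a) * hee a
    rw [this, hA, hv, hAv]; ring) a
  linarith

/-! ### The (anti-)de Sitter and Minkowski backgrounds -/

/-- The signs `-1, 1, …, 1` of the Minkowski metric. -/
def minkowskiSign (n : ℕ) (a : Fin n) : ℝ := if a.val = 0 then -1 else 1

theorem minkowskiSign_mul_self (a : Fin n) : minkowskiSign n a * minkowskiSign n a = 1 := by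
  unfold minkowskiSign; split_ifs <;> norm_num

/-- Half the logarithmic gradient of the conformal factor: `Ω` is a multiple of `x_j⁻²` with
`j = 0` (de Sitter) or `j = 1` (anti-de Sitter), or constant. -/
noncomputable def conformalGradient (n : ℕ) [NeZero n] (Λ : ℝ) (c : Fin n) (x : Coord n) : ℝ :=
  if 0 < Λ then (if c = 0 then -(x 0)⁻¹ else 0)
  else if Λ < 0 then (if c = 1 then -(x 1)⁻¹ else 0)
  else 0

theorem pderiv_inv_coord (b j : Fin n) {x : Coord n} (hx : x j ≠ 0) :
    pderiv b (fun y => (y j)⁻¹) x = if b = j then -((x j) ^ 2)⁻¹ else 0 := by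
  have h1 : HasFDerivAt (fun y : Coord n => y j)
      (ContinuousLinearMap.proj (R := ℝ) (φ := fun _ => ℝ) j) x := hasFDerivAt_apply j x
  have h2 := (hasDerivAt_inv hx).comp_hasFDerivAt x h1
  have h3 : fderiv ℝ (fun y : Coord n => (y j)⁻¹) x = _ := h2.fderiv
  rw [pderiv, h3]
  by_cases hb : b = j
  · subst hb; simp
  · simp [hb]

theorem differentiableAt_inv_coord (j : Fin n) {x : Coord n} (hx : x j ≠ 0) :
    DifferentiableAt ℝ (fun y : Coord n => (y j)⁻¹) x :=
  (differentiableAt_apply j x).inv hx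

theorem pderiv_mul_inv_sq (C : ℝ) (b j : Fin n) {x : Coord n} (hx : x j ≠ 0) :
    pderiv b (fun y => C * ((y j)⁻¹ * (y j)⁻¹)) x =
      2 * (if b = j then -(x j)⁻¹ else 0) * (C * ((x j)⁻¹ * (x j)⁻¹)) := by
  have hd := differentiableAt_inv_coord j hx
  rw [pderiv_const_mul b C (hd.fun_mul hd), pderiv_mul b hd hd, pderiv_inv_coord b j hx]
  split_ifs
  · field_simp; ring
  · ring

theorem pderiv_neg_inv_coord (b c j : Fin n) {x : Coord n} (hx : x j ≠ 0) :
    pderiv b (fun y => if c = j then -(y j)⁻¹ else 0) x =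
      (if b = j then -(x j)⁻¹ else 0) * (if c = j then -(x j)⁻¹ else 0) := by
  have hd := differentiableAt_inv_coord j hx
  by_cases hc : c = j
  · simp only [hc, if_true]
    have : (fun y : Coord n => -(y j)⁻¹) = fun y => (-1) * (y j)⁻¹ := by funext y; ring
    rw [this, pderiv_const_mul b _ hd, pderiv_inv_coord b j hx]
    split_ifs
    · field_simp
    · ring
  · simp only [hc, if_false, pderiv_const, mul_zero]

section Background

variable [NeZero n] {Λ : ℝ} {x : Coord n}

theorem conformalFactor_ne_zero (hn : 3 ≤ n) (hx : x ∈ backgroundDomain n Λ) :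
    conformalFactor n Λ x ≠ 0 := by
  have h3 : (3 : ℝ) ≤ n := by exact_mod_cast hn
  have h1 : ((n : ℝ) - 2) * ((n : ℝ) - 1) ≠ 0 :=
    mul_ne_zero (by linarith) (by linarith)
  unfold conformalFactor
  split_ifs with hp hm
  · exact div_ne_zero h1 (mul_ne_zero (by positivity) (pow_ne_zero 2 (hx.1 hp)))
  · exact neg_ne_zero.mpr (div_ne_zero h1 (mul_ne_zero (by linarith) (pow_ne_zero 2 (hx.2 hm))))
  · exact one_ne_zero

theorem contDiffAt_conformalFactor (hx : x ∈ backgroundDomain n Λ) :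
    ContDiffAt ℝ 2 (conformalFactor n Λ) x := by
  have hc : ∀ j : Fin n, ContDiffAt ℝ 2 (fun y : Coord n => y j) x := fun j =>
    contDiffAt_pi.mp contDiffAt_id j
  unfold conformalFactor
  split_ifs with hp hm
  · exact contDiffAt_const.div (contDiffAt_const.mul ((hc 0).pow 2))
      (mul_ne_zero (by positivity) (pow_ne_zero 2 (hx.1 hp)))
  · exact (contDiffAt_const.div (contDiffAt_const.mul ((hc 1).pow 2))
      (mul_ne_zero (by linarith) (pow_ne_zero 2 (hx.2 hm)))).neg
  · exact contDiffAt_const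

theorem pderiv_conformalFactor (hx : x ∈ backgroundDomain n Λ) (c : Fin n) :
    pderiv c (conformalFactor n Λ) x =
      2 * conformalGradient n Λ c x * conformalFactor n Λ x := by
  have hC : ∀ C j, (fun y : Coord n => C / (2 * Λ * y j ^ 2)) =
      fun y => C / (2 * Λ) * ((y j)⁻¹ * (y j)⁻¹) := by
    intro C j; funext y; rw [← div_div, div_eq_mul_inv _ (y j ^ 2), sq, mul_inv]
  have hC' : ∀ C j, (fun y : Coord n => -(C / (2 * Λ * y j ^ 2))) =
      fun y => -(C / (2 * Λ)) * ((y j)⁻¹ * (y j)⁻¹) := by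
    intro C j; funext y; rw [congrFun (hC C j) y, neg_mul]
  unfold conformalGradient
  by_cases hp : 0 < Λ
  · have : conformalFactor n Λ = fun y =>
        ((n : ℝ) - 2) * ((n : ℝ) - 1) / (2 * Λ) * ((y 0)⁻¹ * (y 0)⁻¹) := by
      unfold conformalFactor; simp only [hp, if_true]; exact hC _ 0
    rw [this]
    simp only [hp, if_true]
    exact pderiv_mul_inv_sq _ c 0 (hx.1 hp)
  · by_cases hm : Λ < 0
    · have : conformalFactor n Λ = fun y =>
          -(((n : ℝ) - 2) * ((n : ℝ) - 1) / (2 * Λ)) * ((y 1)⁻¹ * (y 1)⁻¹) := by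
        unfold conformalFactor; simp only [hp, hm, if_true, if_false]; exact hC' _ 1
      rw [this]
      simp only [hp, hm, if_true, if_false]
      exact pderiv_mul_inv_sq _ c 1 (hx.2 hm)
    · have : conformalFactor n Λ = fun _ => 1 := by
        unfold conformalFactor; simp only [hp, hm, if_false]
      rw [this, pderiv_const]
      simp [hp, hm]

theorem differentiableAt_conformalGradient (hx : x ∈ backgroundDomain n Λ) (c : Fin n) :
    DifferentiableAt ℝ (conformalGradient n Λ c) x := by
  unfold conformalGradient
  split_ifs with hp hc hm hc
  · exact (differentiableAt_inv_coord 0 (hx.1 hp)).fun_neg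
  · exact differentiableAt_const _
  · exact (differentiableAt_inv_coord 1 (hx.2 hm)).fun_neg
  · exact differentiableAt_const _
  · exact differentiableAt_const _

/-- The identity that makes the backgrounds Einstein: it holds for `φ = -d log |x_j|`. -/
theorem pderiv_conformalGradient (hx : x ∈ backgroundDomain n Λ) (b c : Fin n) :
    pderiv b (conformalGradient n Λ c) x =
      conformalGradient n Λ b x * conformalGradient n Λ c x := by
  unfold conformalGradient
  by_cases hp : 0 < Λ
  · simp only [hp, if_true]
    exact pderiv_neg_inv_coord b c 0 (hx.1 hp)
  · by_cases hm : Λ < 0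
    · simp only [hp, hm, if_true, if_false]
      exact pderiv_neg_inv_coord b c 1 (hx.2 hm)
    · simp only [hp, hm, if_false, pderiv_const, mul_zero]

theorem background_inv (hn : 3 ≤ n) (hx : x ∈ backgroundDomain n Λ) :
    (background n Λ x)⁻¹ = (conformalFactor n Λ x)⁻¹ • Matrix.diagonal (minkowskiSign n) := by
  refine Matrix.inv_eq_right_inv ?_
  change (conformalFactor n Λ x • Matrix.diagonal (minkowskiSign n)) * _ = _
  rw [Matrix.smul_mul, Matrix.mul_smul, smul_smul, mul_inv_cancel₀ (conformalFactor_ne_zero hn hx),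
    one_smul, Matrix.diagonal_mul_diagonal]
  simp [minkowskiSign_mul_self]

theorem isUnit_det_background (hn : 3 ≤ n) (hx : x ∈ backgroundDomain n Λ) :
    IsUnit (background n Λ x).det := by
  rw [background, Matrix.det_smul, minkowski, Matrix.det_diagonal, isUnit_iff_ne_zero]
  refine mul_ne_zero (pow_ne_zero _ (conformalFactor_ne_zero hn hx)) (prod_ne_zero_iff.mpr ?_)
  intro a _
  split_ifs <;> norm_num

theorem lower_background (k : Coord n → Fin n → ℝ) (a : Fin n) :
    lower (background n Λ) k x a = conformalFactor n Λ x * (minkowskiSign n a * k x a) := by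
  simp [lower, background, minkowski, Matrix.diagonal_apply, minkowskiSign]

theorem isKerrSchildData_background (hn : 3 ≤ n) {U : Set (Coord n)} (hU : IsOpen U)
    (hUdom : U ⊆ backgroundDomain n Λ) {H : Coord n → ℝ} (hH : ContDiffOn ℝ 2 H U)
    {k : Coord n → Fin n → ℝ} (hk : ContDiffOn ℝ 2 k U)
    (hnull : ∀ x ∈ U, contract (background n Λ) x (k x) (k x) = 0) :
    IsKerrSchildData U (background n Λ) H k where
  isOpen := hU
  symm _ := (Matrix.isSymm_diagonal _).smul _
  isUnit_det _ hx := isUnit_det_background hn (hUdom hx)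
  contDiffAt_metric _ hx _ _ := (contDiffAt_conformalFactor (hUdom hx)).mul contDiffAt_const
  contDiffAt_function _ hx := hH.contDiffAt (hU.mem_nhds hx)
  contDiffAt_vector _ hx a := contDiffAt_pi.mp (hk.contDiffAt (hU.mem_nhds hx)) a
  null := hnull

theorem sum_minkowskiSign_null (hn : 3 ≤ n) (hx : x ∈ backgroundDomain n Λ)
    {k : Coord n → Fin n → ℝ} (h : contract (background n Λ) x (k x) (k x) = 0) :
    ∑ a, minkowskiSign n a * k x a * k x a = 0 := by
  rw [contract_self_eq_lower] at h
  simp only [lower_background, mul_assoc, ← mul_sum] at h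
  simpa [mul_assoc] using (mul_eq_zero.mp h).resolve_left (conformalFactor_ne_zero hn hx)

/-- The part of the Einstein condition on the background that matters here. -/
theorem contract_ricci_background (hn : 3 ≤ n) {U : Set (Coord n)} (hU : IsOpen U)
    (hUdom : U ⊆ backgroundDomain n Λ) (hx : x ∈ U) {k : Coord n → Fin n → ℝ}
    (h : contract (background n Λ) x (k x) (k x) = 0) :
    contract (ricci (background n Λ)) x (k x) (k x) = 0 :=
  contract_ricci_conformal minkowskiSign_mul_self hU
    (fun y hy => (contDiffAt_conformalFactor (hUdom hy)).differentiableAt (by norm_num))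
    (fun y hy => conformalFactor_ne_zero hn (hUdom hy))
    (fun y hy c => differentiableAt_conformalGradient (hUdom hy) c)
    (fun y hy c => pderiv_conformalFactor (hUdom hy) c)
    (fun y hy b c => pderiv_conformalGradient (hUdom hy) b c) hx
    (sum_minkowskiSign_null hn (hUdom hx) h)

/-- `k` is geodetic at a point exactly when its acceleration, which is orthogonal to `k`, is null
there. -/
theorem exists_acceleration_eq_iff (hn : 3 ≤ n) {U : Set (Coord n)}
    (hUdom : U ⊆ backgroundDomain n Λ) {H : Coord n → ℝ} {k : Coord n → Fin n → ℝ}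
    (D : IsKerrSchildData U (background n Λ) H k) (hx : x ∈ U) (hk0 : k x ≠ 0) :
    (∃ μ : ℝ, ∀ a, acceleration (background n Λ) k x a = μ * lower (background n Λ) k x a) ↔
      ∑ a, ∑ b, (background n Λ x)⁻¹ a b * acceleration (background n Λ) k x a *
        acceleration (background n Λ) k x b = 0 := by
  have hAk := D.sum_acceleration_mul hx
  have hΩ := conformalFactor_ne_zero hn (hUdom hx)
  set A := acceleration (background n Λ) k x
  constructor
  · rintro ⟨μ, hμ⟩
    have : ∑ a, ∑ b, (background n Λ x)⁻¹ a b * A a * A b =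
        ∑ a, μ * A a * ∑ b, (background n Λ x)⁻¹ a b * lower (background n Λ) k x b := by
      refine sum_congr rfl fun a _ => ?_
      rw [mul_sum]
      exact sum_congr rfl fun b _ => by rw [hμ b]; ring
    rw [this]
    simp only [D.sum_inv_mul_lower hx, mul_assoc, ← mul_sum, hAk, mul_zero]
  · intro h
    rw [background_inv hn (hUdom hx)] at h
    simp only [Matrix.smul_apply, Matrix.diagonal_apply, smul_eq_mul, mul_ite, mul_zero, ite_mul,
      zero_mul, sum_ite_eq, mem_univ, if_true, mul_assoc, ← mul_sum] at h
    have h' := (mul_eq_zero.mp h).resolve_left (inv_ne_zero hΩ)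
    obtain ⟨μ, hμ⟩ := exists_eq_mul_of_null_of_orthogonal (e := minkowskiSign n)
      (by simp [minkowskiSign])
      (fun a ha => if_neg fun h0 => ha (Fin.ext (by simp [h0]))) hk0
      (by simpa only [mul_assoc] using h') (sum_minkowskiSign_null hn (hUdom hx) (D.null x hx)) hAk
    refine ⟨μ / conformalFactor n Λ x, fun a => ?_⟩
    rw [hμ a, lower_background]
    field_simp

end Background

end KerrSchild

theorem mainTheorem3 (n : ℕ) [NeZero n] (hn : 3 ≤ n) (Λ Λ' : ℝ)
    (U : Set (KerrSchild.Coord n)) (hU : IsOpen U) (hUdom : U ⊆ KerrSchild.backgroundDomain n Λ)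
    (H : KerrSchild.Coord n → ℝ) (hH : ContDiffOn ℝ 2 H U)
    (k : KerrSchild.Coord n → Fin n → ℝ) (hk : ContDiffOn ℝ 2 k U)
    (hk0 : ∀ x ∈ U, k x ≠ 0)
    (hnull : ∀ x ∈ U, KerrSchild.contract (KerrSchild.background n Λ) x (k x) (k x) = 0)
    (T : KerrSchild.TensorField n)
    (hT : KerrSchild.EinsteinEquations U (KerrSchild.gksMetric n Λ H k) Λ' T) :
    (∀ x ∈ U, ∀ m : Fin n → Fin n → ℝ,
      KerrSchild.IsNullFrame (KerrSchild.gksMetric n Λ H k) x m → m 1 = k x →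
        KerrSchild.contract (KerrSchild.ricci (KerrSchild.gksMetric n Λ H k)) x (k x) (k x) =
          2 * H x * ∑ i : Fin n with 2 ≤ i.val,
            KerrSchild.rotationL0 (KerrSchild.gksMetric n Λ H k) k x (m i) ^ 2) ∧
    (U ⊆ closure {x ∈ U | H x ≠ 0} →
      (KerrSchild.IsGeodetic U (KerrSchild.gksMetric n Λ H k) k ↔
        ∀ x ∈ U, KerrSchild.contract T x (k x) (k x) = 0)) := by
  open KerrSchild Finset in
  have D := isKerrSchildData_background hn hU hUdom hH hk hnull
  have hg : gksMetric n Λ H k = kerrSchild (background n Λ) H k := rfl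
  rw [hg] at hT ⊢
  set A := acceleration (background n Λ) k
  have hAg : ∀ x ∈ U, ∀ a, acceleration (kerrSchild (background n Λ) H k) k x a = A x a :=
    fun x hx a => D.acceleration_kerrSchild hx a
  have hric : ∀ x ∈ U, contract (ricci (kerrSchild (background n Λ) H k)) x (k x) (k x) =
      2 * H x * ∑ a, ∑ b, (background n Λ x)⁻¹ a b * A x a * A x b := by
    intro x hx
    rw [D.contract_ricci_kerrSchild hx, contract_ricci_background hn hU hUdom hx (hnull x hx),
      zero_add]
  refine ⟨fun x hx m hm hm1 => ?_, fun hdense => ?_⟩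
  · have hAk : ∑ a, A x a * k x a = 0 := D.sum_acceleration_mul hx
    simp only [rotationL0_eq, hAg x hx]
    rw [hric x hx, ← hm.sum_inv_mul_mul (by omega) (by rw [hm1]; exact hAk)]
    congr 1
    -- The two inverse metrics differ by `2 H k^a k^b`, which annihilates the acceleration.
    have : ∑ a, ∑ b, (kerrSchild (background n Λ) H k x)⁻¹ a b * A x a * A x b =
        ∑ a, ∑ b, (background n Λ x)⁻¹ a b * A x a * A x b
          + 2 * H x * ((∑ a, A x a * k x a) * ∑ a, A x a * k x a) := by
      rw [sum_mul_sum]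
      simp only [D.kerrSchild_inv hx, Matrix.add_apply, Matrix.of_apply, mul_sum,
        ← sum_add_distrib]
      exact sum_congr rfl fun a _ => sum_congr rfl fun b _ => by ring
    rw [this, hAk]
    ring
  · have hgeo : IsGeodetic U (kerrSchild (background n Λ) H k) k ↔
        ∀ x ∈ U, ∑ a, ∑ b, (background n Λ x)⁻¹ a b * A x a * A x b = 0 := by
      refine forall₂_congr fun x hx => ?_
      rw [← exists_acceleration_eq_iff hn hUdom D hx (hk0 x hx)]
      refine exists_congr fun μ => forall_congr' fun a => ?_
      change acceleration (kerrSchild (background n Λ) H k) k x a = _ ↔ _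
      rw [hAg x hx, D.lower_kerrSchild hx]
    have hTx : ∀ x ∈ U, contract T x (k x) (k x) = 0 ↔
        H x * ∑ a, ∑ b, (background n Λ x)⁻¹ a b * A x a * A x b = 0 := by
      intro x hx
      have h1 := D.contract_energyMomentum hx hT
      rw [hric x hx] at h1
      have hpi := Real.pi_pos
      constructor <;> intro h
      · rw [h] at h1; linarith
      · rw [mul_assoc, h] at h1
        have : Real.pi * contract T x (k x) (k x) = 0 := by linarith
        exact (mul_eq_zero.mp this).resolve_left hpi.ne'
    rw [hgeo]
    refine ⟨fun h x hx => (hTx x hx).mpr (by rw [h x hx, mul_zero]), fun h x hx => ?_⟩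
    -- The norm of the acceleration vanishes where `H ≠ 0`, hence everywhere by continuity.
    by_contra hne
    have hev := (D.continuousAt_acceleration_sq hx).eventually_ne hne
    obtain ⟨y, ⟨hyU, hyH⟩, hy⟩ := ((mem_closure_iff_frequently.mp (hdense hx)).and_eventually
      hev).exists
    exact hy ((mul_eq_zero.mp ((hTx y hyU).mp (h y hyU))).resolve_left hyH)
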